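/- Let $p$ be a prime, $c\ge 1$ and $\eta\ge 1$ integers, and $\gamma = 1-p^{-c}$. For a prime power $q$ and $0\le d\le q-1$ let $\mathrm{RS}_q(d)\subseteq\mathbb F_q^q$ be the code of all evaluation vectors $(g(t))_{t\in\mathbb F_q}$ with $g\in\mathbb F_q[T]$, $\deg g\le d$, and let $\mathrm{Lift}^\eta\mathrm{RS}_q(d)\subseteq\mathbb F_q^{q^2}$ be the code of all evaluation vectors $(f(x,y))_{(x,y)\in\mathbb F_q^2}$, where $f\in\mathbb F_q[X,Y]$ is such that $(f(t,\phi(t)))_{t\in\mathbb F_q}\in\mathrm{RS}_q(d)$ for every $\phi\in\mathbb F_q[T]$ with $\deg\phi\le\eta$. Put $$T_m=\Big(\Big\lfloor\tfrac{p^m-1}{\eta}\Big\rfloor+1\Big)\Big(p^m-\tfrac{\eta}{2}\Big\lfloor\tfrac{p^m-1}{\eta}\Big\rfloor\Big),\qquad N_0=1,\qquad N_m=p^{2m}-\sum_{\nu=0}^{m-1}N_\nu T_{m-\nu}\quad(m\ge1).$$ For $e\ge c+1$ let $\mathcal C_e=\mathrm{Lift}^\eta\mathrm{RS}_{p^e}(\gamma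 p^e)$, a linear code of length $n_e=p^{2e}$, and let $R_e=\dim\mathcal C_e/n_e$ be its information rate. Then: 1. The limit $\lim_{e\to\infty}R_e$ exists and $$\lim_{e\to\infty}R_e\ \ge\ \frac1{2\eta}\sum_{\epsilon=0}^{c-1}\big(p^{-\epsilon}-p^{-c}\big)^2N_\epsilon\ >\ 0 .$$ 2. The sequence $(\mathcal C_e)$ is asymptotically good: $n_e\to\infty$, and there are constants $\rho,\delta>0$ such that, for all large $e$, the rate of $\mathcal C_e$ is at least $\rho$ and its minimum distance is at least $\delta n_e$. 3. The codes $\mathcal C_e$ are locally correctable from a constant fraction of errors: for every $e\ge c+1$ and every $0<\delta\le(1-\gamma)/4$, the code $\mathcal C_e$ is $(p^e-1,\delta,\epsilon)$-locally correctable with $\epsilon=\frac{3}{1-\gamma}\delta$, and even with $\epsilon=\frac{2}{1-\gamma}\delta$ if $p^e-\gamma p^e$ is even. Moreover $p^e-1\le\dim\mathcal C_e$ for all large $e$. Here a code $\mathcal C\subseteq\mathbb F_q^n$ is $(\ell,\delta,\epsilon)$-locally correctable if there is a probabilistic algorithm which, given a coordinate $i$ and oracle access to a word $y\in\mathbb F_q^n$,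 reads at most $\ell$ coordinates of $y$, and which outputs $c_i$ with probability at least $1-\epsilon$ whenever $y$ is at Hamming distance at most $\delta n$ from the codeword $c\in\mathcal C$. -/

import Mathlib

open Filter Topology

/-! ### Linear codes -/

section Codes

variable {F ι : Type*} [Field F] [Fintype ι]

/-- The information rate `dim C / n` of a linear code of length `n = |ι|`. -/
noncomputable def codeRate (C : Submodule F (ι → F)) : ℝ :=
  (Module.finrank F C : ℝ) / (Fintype.card ι : ℝ)

/-- The minimum distance of a code: the least Hamming distance between two distinct codewords
(with value `0` for a code that has no two distinct codewords). -/
noncomputable def codeMinDist [DecidableEq F] (C : Submodule F (ι → F)) : ℕ :=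
  sInf {m : ℕ | ∃ x ∈ C, ∃ y ∈ C, x ≠ y ∧ m = hammingDist x y}

end Codes

/-- A sequence of linear codes is asymptotically good if the lengths tend to infinity while the
information rate and the relative minimum distance stay bounded away from zero. -/
def AsymptoticallyGood {F ι : ℕ → Type*} [∀ e, Field (F e)] [∀ e, DecidableEq (F e)]
    [∀ e, Fintype (ι e)] (C : ∀ e, Submodule (F e) (ι e → F e)) : Prop :=
  Tendsto (fun e => Fintype.card (ι e)) atTop atTop ∧
    ∃ ρ > (0 : ℝ), ∃ δ > (0 : ℝ), ∀ᶠ e in atTop,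
      ρ ≤ codeRate (C e) ∧ δ * (Fintype.card (ι e) : ℝ) ≤ (codeMinDist (C e) : ℝ)

/-! ### Local correction -/

/-- A deterministic algorithm with oracle access to a word `y : ι → F`: it either stops and
outputs a symbol, or reads one coordinate of `y` and continues depending on the symbol read
(so queries may be adaptive). -/
inductive OracleAlg (ι F : Type*) where
  | output (a : F) : OracleAlg ι F
  | read (i : ι) (next : F → OracleAlg ι F) : OracleAlg ι F

namespace OracleAlg

variable {ι F : Type*}

/-- The output of the algorithm on the word `y`. -/
def run (y : ι → F) : OracleAlg ι F → F
  | output a => a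
  | read i next => run y (next (y i))

/-- The number of coordinates of `y` read by the algorithm. -/
def numReads (y : ι → F) : OracleAlg ι F → ℕ
  | output _ => 0
  | read i next => numReads y (next (y i)) + 1

end OracleAlg

/-- `C` is `(ℓ, δ, ε)`-locally correctable: there is a probabilistic algorithm (a probability
distribution on deterministic oracle algorithms for every input coordinate `i`) that always reads
at most `ℓ` coordinates of the word `y`, and that outputs `c i` with probability at least `1 - ε`
whenever `y` is at Hamming distance at most `δ n` from the codeword `c`. -/
def IsLocallyCorrectable {F ι : Type*} [Field F] [DecidableEq F] [Fintype ι]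
    (C : Submodule F (ι → F)) (ℓ : ℕ) (δ ε : ℝ) : Prop :=
  ∃ Dec : ι → PMF (OracleAlg ι F),
    (∀ i, ∀ A ∈ (Dec i).support, ∀ y : ι → F, A.numReads y ≤ ℓ) ∧
    ∀ (i : ι) (y c : ι → F), c ∈ C → (hammingDist y c : ℝ) ≤ δ * (Fintype.card ι : ℝ) →
      1 - ε ≤ (((Dec i).map (fun A => A.run y)) (c i)).toReal

/-! ### Reed-Solomon codes and their weighted lifts -/

section Lift

variable (F : Type*) [Field F]

/-- The evaluation map `F[T] → F^F`. -/
noncomputable def evLine : Polynomial F →ₗ[F] (F → F) :=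
  LinearMap.pi fun t => Polynomial.leval t

/-- The evaluation map `F[X, Y] → F^(F²)`. -/
noncomputable def evPlane : MvPolynomial (Fin 2) F →ₗ[F] ((Fin 2 → F) → F) :=
  LinearMap.pi fun x => (MvPolynomial.aeval x).toLinearMap

/-- The full-length Reed-Solomon code: evaluations of polynomials of degree at most `d`. -/
noncomputable def RSCode (d : ℕ) : Submodule F (F → F) :=
  (Polynomial.degreeLE F d).map (evLine F)

/-- The polynomials `f(X, Y)` such that for every `η`-line `L = (T, φ(T))`, `deg φ ≤ η`, the
evaluation of `f ∘ L = f(T, φ(T))` is a Reed-Solomon codeword. -/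
noncomputable def liftPolys (η d : ℕ) : Submodule F (MvPolynomial (Fin 2) F) :=
  ⨅ φ ∈ {φ : Polynomial F | φ.natDegree ≤ η},
    (RSCode F d).comap (evLine F ∘ₗ (MvPolynomial.aeval ![Polynomial.X, φ]).toLinearMap)

/-- The `η`-lifting of the Reed-Solomon code `RS(d)`, a code of length `|F|²`. -/
noncomputable def liftRS (η d : ℕ) : Submodule F ((Fin 2 → F) → F) :=
  (liftPolys F η d).map (evPlane F)

theorem mem_liftRS {η d : ℕ} {v : (Fin 2 → F) → F} :
    v ∈ liftRS F η d ↔ ∃ f : MvPolynomial (Fin 2) F,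
      (∀ φ : Polynomial F, φ.natDegree ≤ η →
        (fun t => (MvPolynomial.aeval ![Polynomial.X, φ] f : Polynomial F).eval t) ∈ RSCode F d) ∧
      (fun x => MvPolynomial.eval x f) = v := by
  simp only [liftRS, liftPolys, Submodule.mem_map, Submodule.mem_iInf, Submodule.mem_comap]
  rfl

end Lift

/-! ### The counting sequences -/

/-- `T_m = (⌊(p^m - 1)/η⌋ + 1) (p^m - (η/2) ⌊(p^m - 1)/η⌋)`. -/
noncomputable def seqT (p η m : ℕ) : ℝ :=
  (((p ^ m - 1) / η : ℕ) + 1) * ((p : ℝ) ^ m - (η : ℝ) / 2 * ((p ^ m - 1) / η : ℕ))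

/-- `N_0 = 1` and `N_m = p^(2m) - ∑_{ν < m} N_ν T_{m-ν}`. -/
noncomputable def seqN (p η : ℕ) : ℕ → ℝ
  | 0 => 1
  | m + 1 => (p : ℝ) ^ (2 * (m + 1)) -
      ∑ ν : Fin (m + 1), seqN p η ν.1 * seqT p η (m + 1 - ν.1)
decreasing_by exact ν.2

/-! Write `q = p^e`, `N = p^(e-c)`, `d = q - N`. Along a generic curve `Y = ∑ a_k T^k` the monomial
`X^i Y^j` expands into powers `T^(i + ∑ k l_k)` with multinomial coefficients, and such a
coefficient survives modulo `p` exactly when the `l_k` add without carries. Hence the lifted code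
has a basis of monomials: those all of whose surviving exponents reduce to at most `d`
(`liftRS_eq_span`). The dimension becomes a count of digit patterns.

Lower bound: without carries the low `m` digits of the exponent are controlled by the low digits
`(u, v)` of `(i, j)`. If `u + η v` is small enough, the exponent misses the top window of length `N`
(`isGoodExp_of_low_digits`). Sorting all pairs by the longest low part inside the triangle `u + η v
< p^k` gives a partition whose cardinalities obey the recursion of `seqN` (`seqN_eq_card`). The
blocks with fewer than `c` high digits, with slightly shrunken triangles, are good; triangle areas
yield the bound.

Limit: a bad pair generally has a witness that survives appending a digit to `i` and `j`. The
exceptions number `O(q)`, since `i + η j` is then confined to boundedly many classes modulo `N`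
(`hasStableWitness_or`). The density of bad pairs is thus increasing up to a summable error, and
bounded.

Distance and correction use only straight lines through a point. The `q` nonvertical ones meet
nowhere else, so a nonzero codeword is nonzero often on each of them, and a random one usually
carries few errors, so that unique decoding on it recovers the value. -/

/-! ### Multinomial coefficients modulo a prime -/

/-- The base-`p` additions in the sum `∑ k, l k` produce no carries. -/
def CarryFree {κ : Type*} [Fintype κ] (p : ℕ) (l : κ → ℕ) : Prop :=
  ∀ m, ∑ k, l k % p ^ m < p ^ m

theorem sum_div_add_div {κ : Type*} [Fintype κ] (l : κ → ℕ) {n : ℕ} (hn : 0 < n) :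
    (∑ k, l k) / n = ∑ k, l k / n + (∑ k, l k % n) / n := by
  have h : ∑ k, l k = n * ∑ k, l k / n + ∑ k, l k % n := by
    rw [Finset.mul_sum, ← Finset.sum_add_distrib]
    exact Finset.sum_congr rfl fun k _ => (Nat.div_add_mod _ _).symm
  rw [h, Nat.mul_add_div hn]

theorem sum_div_eq_iff {κ : Type*} [Fintype κ] (l : κ → ℕ) {n : ℕ} (hn : 0 < n) :
    ∑ k, l k / n = (∑ k, l k) / n ↔ ∑ k, l k % n < n := by
  rw [sum_div_add_div l hn]
  rw [left_eq_add, Nat.div_eq_zero_iff]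
  omega

theorem factorization_multinomial_add {κ : Type*} [Fintype κ] {p : ℕ} (hp : p.Prime) (l : κ → ℕ) :
    (Nat.multinomial Finset.univ l).factorization p +
        ∑ i ∈ Finset.Ico 1 (Nat.log p (∑ k, l k) + 1), ∑ k, l k / p ^ i =
      ∑ i ∈ Finset.Ico 1 (Nat.log p (∑ k, l k) + 1), (∑ k, l k) / p ^ i := by
  rw [← Nat.factorization_factorial hp (Nat.lt_succ_self _), ← Nat.multinomial_spec,
    Nat.factorization_mul (Finset.prod_ne_zero_iff.2 fun k _ => Nat.factorial_ne_zero _)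
      (Nat.multinomial_pos _ _).ne', Nat.factorization_prod fun k _ => Nat.factorial_ne_zero _,
    Finsupp.add_apply, Finset.sum_comm, add_comm, Finsupp.finsetSum_apply]
  congr 1
  refine Finset.sum_congr rfl fun k _ => (Nat.factorization_factorial hp ?_).symm
  exact Nat.lt_succ_of_le (Nat.log_mono_right (Finset.single_le_sum (fun _ _ => Nat.zero_le _)
    (Finset.mem_univ k)))

/-- Kummer's criterion via Legendre's formula: the `p`-adic valuation is a sum over `i` of the
nonnegative defects `⌊∑ l / p^i⌋ - ∑ ⌊l / p^i⌋`, so it vanishes only if each defect does. -/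
theorem not_prime_dvd_multinomial_iff {κ : Type*} [Fintype κ] {p : ℕ} (hp : p.Prime) (l : κ → ℕ) :
    ¬ p ∣ Nat.multinomial Finset.univ l ↔ CarryFree p l := by
  have hle : ∀ i ∈ Finset.Ico 1 (Nat.log p (∑ k, l k) + 1),
      ∑ k, l k / p ^ i ≤ (∑ k, l k) / p ^ i := fun i _ => by
    rw [sum_div_add_div l (pow_pos hp.pos i)]; exact Nat.le_add_right _ _
  have h0 : ¬ p ∣ Nat.multinomial Finset.univ l ↔
      (Nat.multinomial Finset.univ l).factorization p = 0 := by
    rw [Nat.factorization_eq_zero_iff]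
    simp [hp, (Nat.multinomial_pos Finset.univ l).ne']
  have h1 := factorization_multinomial_add hp l
  have h2 : (Nat.multinomial Finset.univ l).factorization p = 0 ↔
      ∑ i ∈ Finset.Ico 1 (Nat.log p (∑ k, l k) + 1), ∑ k, l k / p ^ i =
      ∑ i ∈ Finset.Ico 1 (Nat.log p (∑ k, l k) + 1), (∑ k, l k) / p ^ i := by omega
  rw [h0, h2, Finset.sum_eq_sum_iff_of_le hle]
  constructor
  · intro h m
    by_cases hm : m ∈ Finset.Ico 1 (Nat.log p (∑ k, l k) + 1)
    · exact (sum_div_eq_iff l (pow_pos hp.pos m)).1 (h m hm)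
    · rcases Nat.eq_zero_or_pos m with rfl | hm0
      · simp [Nat.mod_one]
      · have hlog : Nat.log p (∑ k, l k) < m := by
          simp only [Finset.mem_Ico] at hm; omega
        exact (Finset.sum_le_sum fun k _ => Nat.mod_le _ _).trans_lt
          (Nat.lt_pow_of_log_lt hp.one_lt hlog)
  · intro h i _
    exact (sum_div_eq_iff l (pow_pos hp.pos i)).2 (h i)

theorem CarryFree.sum_mod {κ : Type*} [Fintype κ] {p : ℕ} {l : κ → ℕ} (h : CarryFree p l) (m : ℕ) :
    ∑ k, l k % p ^ m = (∑ k, l k) % p ^ m := by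
  rw [Finset.sum_nat_mod, Nat.mod_eq_of_lt (h m)]

/-! ### Exponents of functions on a finite field -/

/-- The exponent in `[0, q - 1]` that defines the same power function on a field with `q`
elements as `n`. -/
def redExp (q n : ℕ) : ℕ := if n = 0 then 0 else (n - 1) % (q - 1) + 1

theorem redExp_lt {q : ℕ} (hq : 2 ≤ q) (n : ℕ) : redExp q n < q := by
  unfold redExp
  split_ifs
  · omega
  · have := Nat.mod_lt (n - 1) (show 0 < q - 1 by omega)
    omega

theorem redExp_of_lt {q n : ℕ} (hn : n < q) : redExp q n = n := by
  unfold redExp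
  split_ifs with h
  · exact h.symm
  · rw [Nat.mod_eq_of_lt (by omega)]; omega

theorem redExp_eq_of_eq {q n M s : ℕ} (h : n = M * (q - 1) + s) (hs : 1 ≤ s) (hsq : s < q) :
    redExp q n = s := by
  have h2 : n - 1 = (s - 1) + (q - 1) * M := by
    rw [h, mul_comm]; omega
  rw [redExp, if_neg (by omega), h2, Nat.add_mul_mod_self_left, Nat.mod_eq_of_lt (by omega)]
  omega

/-- As `q ≡ 1` modulo `q - 1`, the quotient by `q` folds onto the remainder; `r + M < q` rules out a
second wrap. -/
theorem redExp_of_eq {q n M r : ℕ} (h : n = M * q + r) (hr : r + M < q) :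
    redExp q n = r + M := by
  by_cases hz : r + M = 0
  · have h1 : M = 0 := by omega
    rw [h, h1, zero_mul, redExp, if_pos (by omega)]
    omega
  · refine redExp_eq_of_eq (M := M) ?_ (by omega) hr
    obtain ⟨q', rfl⟩ : ∃ q', q = q' + 1 := ⟨q - 1, by omega⟩
    rw [h, Nat.add_sub_cancel, mul_add, mul_one]
    omega

theorem pow_redExp {F : Type*} [Field F] [Fintype F] (t : F) (n : ℕ) :
    t ^ redExp (Fintype.card F) n = t ^ n := by
  unfold redExp
  split_ifs with h
  · rw [h]
  · by_cases ht : t = 0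
    · simp [ht, h]
    · obtain ⟨m, rfl⟩ : ∃ m, n = m + 1 := ⟨n - 1, by omega⟩
      rw [Nat.add_sub_cancel, pow_succ, pow_succ]
      congr 1
      conv_rhs => rw [← Nat.div_add_mod m (Fintype.card F - 1), pow_add, pow_mul,
        FiniteField.pow_card_sub_one_eq_one t ht, one_pow, one_mul]

/-- Two exponents below `q` whose shifts reduce to the same exponent agree, apart from `0` and
`q - 1`. -/
theorem eq_of_redExp_add_eq {q i j w : ℕ} (hi : i < q - 1) (hj : j < q - 1)
    (h : redExp q (i + w) = redExp q (j + w)) : i = j := by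
  have key : ∀ n, redExp q n ≡ n [MOD (q - 1)] := by
    intro n
    unfold redExp
    split_ifs with h0
    · rw [h0]
    · have := (Nat.mod_modEq (n - 1) (q - 1)).add_right 1
      rwa [Nat.sub_add_cancel (by omega)] at this
  have h1 : i + w ≡ j + w [MOD (q - 1)] := (key _).symm.trans (h ▸ key _)
  exact (Nat.ModEq.add_right_cancel' w h1).eq_of_lt_of_lt hi hj

theorem coeff_eq_zero_of_sum_prod_pow_eq_zero {F σ : Type*} [Field F] [Fintype F] [Fintype σ]
    [DecidableEq σ]
    (s : Finset (σ → ℕ)) (hs : ∀ l ∈ s, ∀ k, l k < Fintype.card F) (g : (σ → ℕ) → F)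
    (h : ∀ a : σ → F, ∑ l ∈ s, g l * ∏ k, a k ^ l k = 0) : ∀ l ∈ s, g l = 0 := by
  classical
  set P : MvPolynomial σ F :=
    ∑ l ∈ s, MvPolynomial.monomial (Finsupp.equivFunOnFinite.symm l) (g l) with hP
  have hcoeff : ∀ u : σ →₀ ℕ, P.coeff u = if (u : σ → ℕ) ∈ s then g u else 0 := by
    intro u
    rw [hP, MvPolynomial.coeff_sum]
    simp only [MvPolynomial.coeff_monomial, Equiv.symm_apply_eq]
    rw [Finset.sum_ite_eq' s]
    rfl
  have hP0 : P = 0 := by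
    refine MvPolynomial.eq_zero_of_eval_zero_at_prod_finset P (fun _ => Finset.univ) ?_ ?_
    · intro k
      rw [MvPolynomial.degreeOf_lt_iff (by simp [Finset.card_univ, Fintype.card_pos])]
      intro u hu
      rw [MvPolynomial.mem_support_iff, hcoeff] at hu
      by_cases hus : (u : σ → ℕ) ∈ s
      · exact hs _ hus k
      · simp [hus] at hu
    · intro a _
      rw [← h a, hP, map_sum]
      refine Finset.sum_congr rfl fun l _ => ?_
      rw [MvPolynomial.eval_monomial, Finsupp.prod_fintype _ _ (by simp)]
      rfl
  intro l hl
  have := hcoeff (Finsupp.equivFunOnFinite.symm l)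
  rw [hP0] at this
  simpa [hl] using this.symm

/-! ### A monomial basis of the lifted code -/

/-- The exponent of `T` contributed by the summand with index `l` in the multinomial expansion of
a power of `∑ k, a k T ^ k`. -/
def expWeight {η : ℕ} (l : Fin (η + 1) → ℕ) : ℕ := ∑ k : Fin (η + 1), (k : ℕ) * l k

/-- All the exponents that occur in `X ^ i Y ^ j` along a generic curve `Y = φ(X)` of degree `η`
reduce to exponents at most `d`. -/
def IsGoodExp (p η q d i j : ℕ) : Prop :=
  ∀ l : Fin (η + 1) → ℕ, CarryFree p l → ∑ k, l k = j → redExp q (i + expWeight l) ≤ d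

open Classical in
/-- The exponents `(i, j)` of the monomials spanning the lifted code. -/
noncomputable def goodExps (p η q d : ℕ) : Finset (ℕ × ℕ) :=
  {ij ∈ Finset.range q ×ˢ Finset.range q | IsGoodExp p η q d ij.1 ij.2}

theorem mem_goodExps {p η q d : ℕ} {ij : ℕ × ℕ} :
    ij ∈ goodExps p η q d ↔ (ij.1 < q ∧ ij.2 < q) ∧ IsGoodExp p η q d ij.1 ij.2 := by
  simp [goodExps]

section

variable {F : Type*} [Field F]

/-- The function defined by the monomial `X ^ i Y ^ j`. -/
def monomialFun (F : Type*) [Field F] (ij : ℕ × ℕ) : (Fin 2 → F) → F :=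
  fun x => x 0 ^ ij.1 * x 1 ^ ij.2

theorem mul_pow_curve {η : ℕ} (a : Fin (η + 1) → F) (t : F) (i j : ℕ) :
    t ^ i * (∑ k, a k * t ^ (k : ℕ)) ^ j =
      ∑ l ∈ Finset.piAntidiag Finset.univ j,
        (Nat.multinomial Finset.univ l : F) * (∏ k, a k ^ l k) * t ^ (i + expWeight l) := by
  rw [Finset.sum_pow_eq_sum_piAntidiag, Finset.mul_sum]
  refine Finset.sum_congr rfl fun l _ => ?_
  simp only [mul_pow, Finset.prod_mul_distrib, ← pow_mul, Finset.prod_pow_eq_pow_sum, pow_add,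
    expWeight]
  ring

theorem mem_RSCode_iff {d : ℕ} {v : F → F} :
    v ∈ RSCode F d ↔ ∃ g : Polynomial F, g.natDegree ≤ d ∧ ∀ t, v t = g.eval t := by
  simp only [RSCode, Submodule.mem_map, Polynomial.mem_degreeLE,
    ← Polynomial.natDegree_le_iff_degree_le]
  constructor
  · rintro ⟨g, hg, rfl⟩
    exact ⟨g, hg, fun t => rfl⟩
  · rintro ⟨g, hg, hv⟩
    exact ⟨g, hg, funext fun t => (hv t).symm⟩

theorem pow_mem_RSCode {d s : ℕ} (hs : s ≤ d) : (fun t : F => t ^ s) ∈ RSCode F d :=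
  mem_RSCode_iff.2 ⟨Polynomial.X ^ s, (Polynomial.natDegree_X_pow_le s).trans hs, by simp⟩

theorem eval_aeval_curve (f : MvPolynomial (Fin 2) F) (φ : Polynomial F) (t : F) :
    (MvPolynomial.aeval ![Polynomial.X, φ] f : Polynomial F).eval t =
      MvPolynomial.eval ![t, φ.eval t] f := by
  rw [← Polynomial.coe_evalRingHom, MvPolynomial.aeval_def, MvPolynomial.hom_eval₂,
    MvPolynomial.eval, MvPolynomial.coe_eval₂Hom]
  congr 1
  · ext; simp
  · funext k
    fin_cases k <;> simp

variable [Fintype F]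

theorem coeff_eq_zero_of_mem_RSCode {d : ℕ} (hd : d < Fintype.card F) (c : ℕ → F)
    (h : (fun t : F => ∑ s ∈ Finset.range (Fintype.card F), c s * t ^ s) ∈ RSCode F d)
    {s : ℕ} (hs : s < Fintype.card F) (hds : d < s) : c s = 0 := by
  classical
  obtain ⟨g, hg, hv⟩ := mem_RSCode_iff.1 h
  set G : Polynomial F :=
    ∑ s ∈ Finset.range (Fintype.card F), Polynomial.C (c s) * Polynomial.X ^ s with hG
  have hGdeg : G.degree < Fintype.card F := by
    rw [← Polynomial.mem_degreeLT]
    refine Submodule.sum_mem _ fun s hs => Polynomial.mem_degreeLT.2 ?_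
    exact (Polynomial.degree_C_mul_X_pow_le s (c s)).trans_lt
      (by exact_mod_cast Finset.mem_range.1 hs)
  have hgdeg : g.degree < Fintype.card F :=
    (Polynomial.degree_le_natDegree).trans_lt (by exact_mod_cast hg.trans_lt hd)
  have hEq : G = g := by
    refine Polynomial.eq_of_degrees_lt_of_eval_finset_eq Finset.univ
      (by simpa using hGdeg) (by simpa using hgdeg) fun t _ => ?_
    rw [← hv t, hG, Polynomial.eval_finsetSum]
    simp
  have h1 : G.coeff s = c s := by
    rw [hG, Polynomial.finsetSum_coeff]
    simp only [Polynomial.coeff_C_mul_X_pow]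
    rw [Finset.sum_ite_eq]
    simp [hs]
  rw [← h1, hEq]
  exact Polynomial.coeff_eq_zero_of_natDegree_lt (hg.trans_lt hds)

theorem linearIndepOn_monomialFun :
    LinearIndepOn F (monomialFun F)
      ↑(Finset.range (Fintype.card F) ×ˢ Finset.range (Fintype.card F)) := by
  classical
  rw [linearIndepOn_finset_iff]
  intro f hf ij hij
  have hinj : Function.Injective fun ij : ℕ × ℕ => (![ij.1, ij.2] : Fin 2 → ℕ) := by
    intro u v huv
    exact Prod.ext (congrFun huv 0) (congrFun huv 1)
  have := coeff_eq_zero_of_sum_prod_pow_eq_zero (F := F)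
    ((Finset.range (Fintype.card F) ×ˢ Finset.range (Fintype.card F)).image
      fun ij : ℕ × ℕ => (![ij.1, ij.2] : Fin 2 → ℕ))
    (by
      intro l hl k
      obtain ⟨u, hu, rfl⟩ := Finset.mem_image.1 hl
      rw [Finset.mem_product, Finset.mem_range, Finset.mem_range] at hu
      fin_cases k
      · exact hu.1
      · exact hu.2)
    (fun l => f (l 0, l 1))
    (by
      intro a
      rw [Finset.sum_image hinj.injOn]
      have h := congrFun hf a
      simpa [monomialFun, Fin.prod_univ_two] using h)
    ![ij.1, ij.2] (Finset.mem_image_of_mem _ hij)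
  simpa using this

theorem finrank_span_monomialFun (s : Finset (ℕ × ℕ))
    (hs : s ⊆ Finset.range (Fintype.card F) ×ˢ Finset.range (Fintype.card F)) :
    Module.finrank F (Submodule.span F (monomialFun F '' s)) = s.card := by
  classical
  have h : LinearIndepOn F (monomialFun F) (s : Set (ℕ × ℕ)) :=
    linearIndepOn_monomialFun.mono (Finset.coe_subset.2 hs)
  rw [← Finset.coe_image, finrank_span_finset_eq_card, Finset.card_image_of_injOn h.injOn]
  rw [Finset.coe_image]
  exact h.id_image

theorem exists_sum_monomialFun (v : (Fin 2 → F) → F) :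
    ∃ f : ℕ × ℕ → F, ∑ ij ∈ Finset.range (Fintype.card F) ×ˢ Finset.range (Fintype.card F),
      f ij • monomialFun F ij = v := by
  classical
  rw [← Submodule.mem_span_image_finset_iff_exists_fun']
  have : Submodule.span F (monomialFun F ''
      ↑(Finset.range (Fintype.card F) ×ˢ Finset.range (Fintype.card F))) = ⊤ := by
    apply Submodule.eq_top_of_finrank_eq
    rw [finrank_span_monomialFun _ subset_rfl, Module.finrank_fintype_fun_eq_card]
    simp [sq]
  rw [this]
  exact Submodule.mem_top

theorem coeff_eq_zero_of_forall_curve {p η d : ℕ} (hp : p.Prime) [CharP F p]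
    (hd : d + 1 < Fintype.card F) (f : ℕ × ℕ → F)
    (h : ∀ a : Fin (η + 1) → F,
      (fun t => ∑ ij ∈ Finset.range (Fintype.card F) ×ˢ Finset.range (Fintype.card F),
        f ij * (t ^ ij.1 * (∑ k, a k * t ^ (k : ℕ)) ^ ij.2)) ∈ RSCode F d)
    {i j : ℕ} (hi : i < Fintype.card F) (hj : j < Fintype.card F)
    (hbad : ¬ IsGoodExp p η (Fintype.card F) d i j) : f (i, j) = 0 := by
  classical
  set q := Fintype.card F with hq
  have hq2 : 2 ≤ q := by omega
  -- For `s > d` the coefficient of `t^s` on the curve is a polynomial in the curve coefficients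
  -- `a`, of degree below `q` in each variable, that vanishes identically. So its coefficient at
  -- `a^l` is zero, and for carry-free `l` the multinomial factor can be cancelled.
  have hsum : ∀ l : Fin (η + 1) → ℕ, ∑ k, l k < q → CarryFree p l → ∀ s, s < q → d < s →
      ∑ i ∈ Finset.range q, (if redExp q (i + expWeight l) = s then f (i, ∑ k, l k) else 0) = 0 := by
    intro l hl hcf s hs hds
    set L : Finset (Fin (η + 1) → ℕ) :=
      (Finset.range q).biUnion fun j => Finset.piAntidiag Finset.univ j with hL
    have hmemL : ∀ l, l ∈ L ↔ ∑ k, l k < q := by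
      intro l
      simp [hL]
    set g : (Fin (η + 1) → ℕ) → F := fun l => (Nat.multinomial Finset.univ l : F) *
      ∑ i ∈ Finset.range q, (if redExp q (i + expWeight l) = s then f (i, ∑ k, l k) else 0) with hg
    have hg0 := coeff_eq_zero_of_sum_prod_pow_eq_zero (F := F) L
      (by
        intro l hl k
        exact (Finset.single_le_sum (f := l) (fun _ _ => Nat.zero_le _)
          (Finset.mem_univ k)).trans_lt ((hmemL l).1 hl)) g
      (by
        intro a
        set c : ℕ → F := fun s => ∑ l ∈ L, (Nat.multinomial Finset.univ l : F) *
          (∑ i ∈ Finset.range q, (if redExp q (i + expWeight l) = s then f (i, ∑ k, l k) else 0)) *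
            ∏ k, a k ^ l k with hc
        have hfun : (fun t => ∑ ij ∈ Finset.range q ×ˢ Finset.range q,
            f ij * (t ^ ij.1 * (∑ k, a k * t ^ (k : ℕ)) ^ ij.2)) =
            fun t : F => ∑ s ∈ Finset.range q, c s * t ^ s := by
          funext t
          have h1 : ∀ l : Fin (η + 1) → ℕ, ∑ s ∈ Finset.range q, ((Nat.multinomial Finset.univ l : F) *
              (∑ i ∈ Finset.range q,
                (if redExp q (i + expWeight l) = s then f (i, ∑ k, l k) else 0)) *
              ∏ k, a k ^ l k) * t ^ s = ∑ i ∈ Finset.range q, f (i, ∑ k, l k) *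
                ((Nat.multinomial Finset.univ l : F) * (∏ k, a k ^ l k) *
                  t ^ (i + expWeight l)) := by
            intro l
            simp only [Finset.mul_sum, Finset.sum_mul]
            rw [Finset.sum_comm]
            refine Finset.sum_congr rfl fun i _ => ?_
            rw [Finset.sum_eq_single (redExp q (i + expWeight l))]
            · rw [if_pos rfl, hq, pow_redExp]; ring
            · intro s _ hs
              rw [if_neg (Ne.symm hs)]; ring
            · intro h
              exact absurd (Finset.mem_range.2 (redExp_lt hq2 _)) h
          simp only [hc, Finset.sum_mul]
          rw [Finset.sum_comm]
          have h2 : ∀ l ∈ L, ∑ s ∈ Finset.range q, ((Nat.multinomial Finset.univ l : F) *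
              (∑ i ∈ Finset.range q,
                (if redExp q (i + expWeight l) = s then f (i, ∑ k, l k) else 0)) *
              ∏ k, a k ^ l k) * t ^ s = _ := fun l _ => h1 l
          rw [Finset.sum_congr rfl h2, hL, Finset.sum_biUnion]
          · rw [Finset.sum_product_right]
            refine Finset.sum_congr rfl fun j _ => ?_
            simp only [mul_pow_curve, Finset.mul_sum]
            rw [Finset.sum_comm]
            refine Finset.sum_congr rfl fun l hl => ?_
            rw [(Finset.mem_piAntidiag.1 hl).1]
          · intro j _ j' _ hjj'
            refine Finset.disjoint_left.2 fun l hl hl' => hjj' ?_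
            rw [← (Finset.mem_piAntidiag.1 hl).1, (Finset.mem_piAntidiag.1 hl').1]
        have := h a
        rw [hfun] at this
        exact coeff_eq_zero_of_mem_RSCode (by omega) c this hs hds) l ((hmemL l).2 hl)
    rcases mul_eq_zero.1 hg0 with h0 | h0
    · rw [CharP.cast_eq_zero_iff F p] at h0
      exact absurd h0 ((not_prime_dvd_multinomial_iff hp l).2 hcf)
    · exact h0
  -- The exponents `0` and `q - 1` are congruent modulo `q - 1` and may collide after a shift. The
  -- column `i = q - 1` is removed first, using `l = (j, 0, …, 0)` of weight zero, where no shift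
  -- takes place.
  have hlast : ∀ j, j < q → f (q - 1, j) = 0 := by
    intro j hj
    have hl : ∑ k, (Pi.single 0 j : Fin (η + 1) → ℕ) k = j := by
      simp
    have hw : expWeight (Pi.single 0 j : Fin (η + 1) → ℕ) = 0 := by
      refine Finset.sum_eq_zero fun k _ => ?_
      rcases eq_or_ne k 0 with rfl | hk
      · simp
      · simp [hk]
    have hcf : CarryFree p (Pi.single 0 j : Fin (η + 1) → ℕ) := by
      intro m
      rw [Finset.sum_eq_single 0]
      · exact Nat.mod_lt _ (pow_pos hp.pos m)
      · intro k _ hk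
        simp [hk]
      · simp
    have := hsum (Pi.single 0 j) (hl.symm ▸ hj) hcf (q - 1) (by omega) (by omega)
    rw [hl, hw, Finset.sum_eq_single (q - 1)] at this
    · simpa [redExp_of_lt (show q - 1 < q by omega)] using this
    · intro i hi hne
      rw [add_zero, redExp_of_lt (Finset.mem_range.1 hi), if_neg hne]
    · intro h
      exact absurd (Finset.mem_range.2 (by omega)) h
  rcases eq_or_ne i (q - 1) with rfl | hne
  · exact hlast j hj
  · simp only [IsGoodExp, not_forall, not_le] at hbad
    obtain ⟨l, hcf, hl, hlt⟩ := hbad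
    have := hsum l (hl.symm ▸ hj) hcf _ (redExp_lt hq2 _) hlt
    rw [hl, Finset.sum_eq_single i] at this
    · simpa using this
    · intro i' hi' hii'
      rw [Finset.mem_range] at hi'
      split_ifs with hr
      · rcases eq_or_ne i' (q - 1) with rfl | hne'
        · exact hlast j hj
        · exact absurd (eq_of_redExp_add_eq (by omega) (by omega) hr) hii'
      · rfl
    · intro h
      exact absurd (Finset.mem_range.2 hi) h

/-- Membership in the lifted code in terms of values only. -/
theorem mem_liftRS_iff_curve {η d : ℕ} {v : (Fin 2 → F) → F} :
    v ∈ liftRS F η d ↔ ∀ a : Fin (η + 1) → F,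
      (fun t => v ![t, ∑ k, a k * t ^ (k : ℕ)]) ∈ RSCode F d := by
  rw [mem_liftRS]
  constructor
  · rintro ⟨f, hf, rfl⟩ a
    have := hf (∑ k : Fin (η + 1), Polynomial.C (a k) * Polynomial.X ^ (k : ℕ))
      (Polynomial.natDegree_sum_le_of_forall_le _ _ fun k _ =>
        (Polynomial.natDegree_C_mul_X_pow_le _ _).trans (by omega))
    simpa [eval_aeval_curve, Polynomial.eval_finsetSum] using this
  · intro h
    -- Every function on the plane is a polynomial function, and the condition on curves depends on
    -- values only.
    obtain ⟨c, hc⟩ := exists_sum_monomialFun v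
    refine ⟨∑ ij ∈ Finset.range (Fintype.card F) ×ˢ Finset.range (Fintype.card F),
      MvPolynomial.C (c ij) * (MvPolynomial.X 0 ^ ij.1 * MvPolynomial.X 1 ^ ij.2), ?_, ?_⟩
    swap
    · rw [← hc]
      funext x
      simp [monomialFun]
    · intro φ hφ
      convert h fun k => φ.coeff k using 2 with t
      rw [eval_aeval_curve, ← hc, Finset.sum_range (fun k => φ.coeff k * t ^ k) |>.symm,
        ← Polynomial.eval_eq_sum_range' (Nat.lt_succ_of_le hφ)]
      simp [monomialFun]

/-- Generic curves force the coefficient of every bad exponent to vanish. Conversely, on a good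
monomial the terms that could exceed degree `d` have a carry, so their coefficients are zero in
characteristic `p`. -/
theorem liftRS_eq_span {p η d : ℕ} (hp : p.Prime) [CharP F p] (hd : d + 1 < Fintype.card F) :
    liftRS F η d = Submodule.span F (monomialFun F '' goodExps p η (Fintype.card F) d) := by
  classical
  apply le_antisymm
  · intro v hv
    rw [mem_liftRS_iff_curve] at hv
    obtain ⟨f, hf⟩ := exists_sum_monomialFun v
    rw [← hf]
    refine Submodule.sum_mem _ fun ij hij => ?_
    rw [Finset.mem_product, Finset.mem_range, Finset.mem_range] at hij
    by_cases hgood : IsGoodExp p η (Fintype.card F) d ij.1 ij.2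
    · exact Submodule.smul_mem _ _ (Submodule.subset_span
        (Set.mem_image_of_mem _ (mem_goodExps.2 ⟨hij, hgood⟩)))
    · have : f (ij.1, ij.2) = 0 := by
        refine coeff_eq_zero_of_forall_curve hp hd f (fun a => ?_) hij.1 hij.2 hgood
        convert hv a using 2 with t
        rw [← hf]
        simp [monomialFun]
      rw [Prod.mk.eta] at this
      rw [this, zero_smul]
      exact Submodule.zero_mem _
  · rw [Submodule.span_le]
    rintro _ ⟨ij, hij, rfl⟩
    obtain ⟨-, hgood⟩ := mem_goodExps.1 hij
    rw [SetLike.mem_coe, mem_liftRS_iff_curve]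
    intro a
    have : (fun t => monomialFun F ij ![t, ∑ k, a k * t ^ (k : ℕ)]) =
        ∑ l ∈ Finset.piAntidiag Finset.univ ij.2,
          ((Nat.multinomial Finset.univ l : F) * (∏ k, a k ^ l k)) •
            fun t => t ^ redExp (Fintype.card F) (ij.1 + expWeight l) := by
      funext t
      simp only [monomialFun, Matrix.cons_val_zero, Matrix.cons_val_one, mul_pow_curve,
        Finset.sum_apply, Pi.smul_apply, smul_eq_mul, pow_redExp]
    rw [this]
    refine Submodule.sum_mem _ fun l hl => ?_
    by_cases hcf : CarryFree p l
    · exact Submodule.smul_mem _ _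
        (pow_mem_RSCode (hgood l hcf (Finset.mem_piAntidiag.1 hl).1))
    · rw [← not_prime_dvd_multinomial_iff hp, not_not, ← CharP.cast_eq_zero_iff F p] at hcf
      rw [hcf, zero_mul, zero_smul]
      exact Submodule.zero_mem _

theorem finrank_liftRS {p η d : ℕ} (hp : p.Prime) [CharP F p] (hd : d + 1 < Fintype.card F) :
    Module.finrank F (liftRS F η d) = (goodExps p η (Fintype.card F) d).card := by
  rw [liftRS_eq_span hp hd, finrank_span_monomialFun]
  intro ij hij
  obtain ⟨h, -⟩ := mem_goodExps.1 hij
  exact Finset.mem_product.2 ⟨Finset.mem_range.2 h.1, Finset.mem_range.2 h.2⟩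

end

/-! ### A lower bound for the number of good exponents -/

theorem expWeight_le {η : ℕ} (l : Fin (η + 1) → ℕ) : expWeight l ≤ η * ∑ k, l k := by
  rw [Finset.mul_sum]
  exact Finset.sum_le_sum fun k _ => Nat.mul_le_mul_right _ (by omega)

/-- Reduction modulo `q - 1` adds this quotient to the residue modulo `q`; the slack `η` in the
later counts pays for it. -/
theorem add_expWeight_div_le {η q i : ℕ} {l : Fin (η + 1) → ℕ} (hi : i < q)
    (hl : ∑ k, l k < q) : (i + expWeight l) / q ≤ η := by
  have h1 := expWeight_le l
  have h2 : η * ∑ k, l k ≤ η * q := Nat.mul_le_mul_left _ hl.le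
  rw [← Nat.lt_succ_iff, Nat.div_lt_iff_lt_mul (by omega), Nat.succ_mul]
  omega

theorem isGoodExp_of_low_digits {p η e m D i j : ℕ} (hp : p.Prime) (hm : m ≤ e) (hD : 1 ≤ D)
    (hi : i < p ^ e) (hj : j < p ^ e)
    (h : i % p ^ m + η * (j % p ^ m) + D + η ≤ p ^ m) :
    IsGoodExp p η (p ^ e) (p ^ e - D) i j := by
  intro l hcf hl
  set S := i + expWeight l with hS
  have hM : S / p ^ e ≤ η := add_expWeight_div_le hi (hl.symm ▸ hj)
  -- Without carries the truncated `l k` sum to exactly `j % p ^ m`, so their weight is at most `η`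
  -- times that.
  have hmod : S % p ^ m ≤ i % p ^ m + η * (j % p ^ m) := by
    have h1 : expWeight (fun k => l k % p ^ m) ≤ η * (j % p ^ m) := by
      rw [← hl, ← hcf.sum_mod]
      exact expWeight_le _
    have h2 : S ≡ i % p ^ m + expWeight (fun k => l k % p ^ m) [MOD p ^ m] := by
      refine Nat.ModEq.add (Nat.mod_modEq _ _).symm ?_
      exact Nat.ModEq.sum fun k _ => Nat.ModEq.mul_left _ (Nat.mod_modEq _ _).symm
    exact (h2.trans_le (Nat.mod_le _ _)).trans (Nat.add_le_add_left h1 _)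
  have hq : p ^ e = p ^ m * p ^ (e - m) := by rw [← pow_add, Nat.add_sub_cancel' hm]
  -- The extreme case has all digits from position `m` up to `e - 1` equal to `p - 1`.
  have hr : S % p ^ e + p ^ m ≤ p ^ e + S % p ^ m := by
    have h1 : S / p ^ m % p ^ (e - m) + 1 ≤ p ^ (e - m) := Nat.mod_lt _ (pow_pos hp.pos _)
    have h2 := Nat.mul_le_mul_left (p ^ m) h1
    rw [hq, Nat.mod_mul]
    rw [mul_add, mul_one] at h2
    omega
  rw [redExp_of_eq (M := S / p ^ e) (r := S % p ^ e) (Nat.div_add_mod' _ _).symm (by omega)]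
  omega

/-! ### Partition of exponent pairs into digit blocks -/

/-- The pairs of `m`-digit numbers no low part of which lies below the line `u + η v = p ^ k`. -/
def primPairs (p η m : ℕ) : Finset (ℕ × ℕ) :=
  {ij ∈ Finset.range (p ^ m) ×ˢ Finset.range (p ^ m) |
    ∀ k ∈ Finset.Icc 1 m, p ^ k ≤ ij.1 % p ^ k + η * (ij.2 % p ^ k)}

/-- The lattice points of the triangle `u + η v < A`. -/
def triangle (η A : ℕ) : Finset (ℕ × ℕ) :=
  {uv ∈ Finset.range A ×ˢ Finset.range A | uv.1 + η * uv.2 < A}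

/-- The pairs with high digits in `N` and low digits in `Z`. -/
def blockPairs (B : ℕ) (N Z : Finset (ℕ × ℕ)) : Finset (ℕ × ℕ) :=
  (N ×ˢ Z).image fun x => (B * x.1.1 + x.2.1, B * x.1.2 + x.2.2)

theorem mem_blockPairs {B : ℕ} {N Z : Finset (ℕ × ℕ)} (hZ : ∀ z ∈ Z, z.1 < B ∧ z.2 < B)
    {ij : ℕ × ℕ} : ij ∈ blockPairs B N Z ↔
      (ij.1 / B, ij.2 / B) ∈ N ∧ (ij.1 % B, ij.2 % B) ∈ Z := by
  simp only [blockPairs, Finset.mem_image, Finset.mem_product]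
  constructor
  · rintro ⟨⟨⟨a, b⟩, ⟨u, v⟩⟩, ⟨hN, hz⟩, rfl⟩
    obtain ⟨hu, hv⟩ := hZ _ hz
    simp only at hu hv
    have hB : 0 < B := by omega
    simp only [Nat.mul_add_div hB, Nat.mul_add_mod, Nat.div_eq_of_lt hu, Nat.div_eq_of_lt hv,
      Nat.mod_eq_of_lt hu, Nat.mod_eq_of_lt hv, add_zero]
    exact ⟨hN, hz⟩
  · rintro ⟨hN, hz⟩
    exact ⟨((ij.1 / B, ij.2 / B), (ij.1 % B, ij.2 % B)), ⟨hN, hz⟩,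
      Prod.ext (Nat.div_add_mod _ _) (Nat.div_add_mod _ _)⟩

theorem card_blockPairs {B : ℕ} {N Z : Finset (ℕ × ℕ)} (hZ : ∀ z ∈ Z, z.1 < B ∧ z.2 < B) :
    (blockPairs B N Z).card = N.card * Z.card := by
  rw [blockPairs, Finset.card_image_of_injOn, Finset.card_product]
  rintro ⟨⟨a, b⟩, ⟨u, v⟩⟩ hx ⟨⟨a', b'⟩, ⟨u', v'⟩⟩ hx' h
  rw [Finset.mem_coe, Finset.mem_product] at hx hx'
  obtain ⟨hu, hv⟩ := hZ _ hx.2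
  obtain ⟨hu', hv'⟩ := hZ _ hx'.2
  simp only [Prod.mk.injEq] at h hu hv hu' hv' ⊢
  have hB : 0 < B := by omega
  have key : ∀ {a a' u u' : ℕ}, u < B → u' < B → B * a + u = B * a' + u' → a = a' ∧ u = u' := by
    intro a a' u u' hu hu' h
    have h1 := congrArg (· / B) h
    have h2 := congrArg (· % B) h
    simp only [Nat.mul_add_div hB, Nat.mul_add_mod, Nat.div_eq_of_lt hu, Nat.div_eq_of_lt hu',
      Nat.mod_eq_of_lt hu, Nat.mod_eq_of_lt hu', add_zero] at h1 h2
    exact ⟨h1, h2⟩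
  obtain ⟨h1, h2⟩ := key hu hu' h.1
  obtain ⟨h3, h4⟩ := key hv hv' h.2
  exact ⟨⟨h1, h3⟩, h2, h4⟩

theorem mem_triangle {η A : ℕ} (hη : 1 ≤ η) {z : ℕ × ℕ} : z ∈ triangle η A ↔ z.1 + η * z.2 < A := by
  simp only [triangle, Finset.mem_filter, Finset.mem_product, Finset.mem_range]
  have : z.2 ≤ η * z.2 := Nat.le_mul_of_pos_left _ hη
  omega

theorem triangle_lt {η A B : ℕ} (hη : 1 ≤ η) (hAB : A ≤ B) :
    ∀ z ∈ triangle η A, z.1 < B ∧ z.2 < B := by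
  intro z hz
  rw [mem_triangle hη] at hz
  have : z.2 ≤ η * z.2 := Nat.le_mul_of_pos_left _ hη
  omega

/-- The first `ν' - ν` digits above the shorter low part lie on or above the line, as part of a
primitive pair. Scaled by `p^(m-ν')` they already push the longer low part out of its triangle. -/
theorem disjoint_blockPairs {p η m ν ν' A A' : ℕ} (hη : 1 ≤ η) (hν : ν < ν')
    (hν' : ν' ≤ m) (hA : A ≤ p ^ (m - ν)) (hA' : A' ≤ p ^ (m - ν')) :
    Disjoint (blockPairs (p ^ (m - ν)) (primPairs p η ν) (triangle η A))
      (blockPairs (p ^ (m - ν')) (primPairs p η ν') (triangle η A')) := by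
  refine Finset.disjoint_left.2 fun ij h h' => ?_
  rw [mem_blockPairs (triangle_lt hη hA), mem_triangle hη] at h
  rw [mem_blockPairs (triangle_lt hη hA'), primPairs, Finset.mem_filter] at h'
  have h1 := h'.1.2 (ν' - ν) (Finset.mem_Icc.2 (by omega))
  have h2 := h.2
  have hpow : p ^ (m - ν) = p ^ (m - ν') * p ^ (ν' - ν) := by
    rw [← pow_add]; congr 1; omega
  simp only at h1 h2
  have h3 := Nat.mul_le_mul_left (p ^ (m - ν')) h1
  have h4 := h2.trans_le hA
  rw [hpow, Nat.mod_mul, Nat.mod_mul] at h4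
  have h5 : η * (ij.2 % p ^ (m - ν') + p ^ (m - ν') * (ij.2 / p ^ (m - ν') % p ^ (ν' - ν))) =
      η * (ij.2 % p ^ (m - ν')) +
        p ^ (m - ν') * (η * (ij.2 / p ^ (m - ν') % p ^ (ν' - ν))) := by ring
  rw [h5] at h4
  rw [mul_add] at h3
  have h6 := Nat.zero_le (ij.1 % p ^ (m - ν'))
  omega

theorem pairwiseDisjoint_blockPairs {p η m : ℕ} (hη : 1 ≤ η) (s : Finset ℕ)
    (hs : ∀ ν ∈ s, ν ≤ m) (A : ℕ → ℕ) (hA : ∀ ν, A ν ≤ p ^ (m - ν)) :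
    (s : Set ℕ).PairwiseDisjoint fun ν =>
      blockPairs (p ^ (m - ν)) (primPairs p η ν) (triangle η (A ν)) := by
  intro ν hν ν' hν' hne
  rcases lt_or_gt_of_ne hne with h | h
  · exact disjoint_blockPairs hη h (hs _ hν') (hA _) (hA _)
  · exact (disjoint_blockPairs hη h (hs _ hν) (hA _) (hA _)).symm

theorem blockPairs_subset {p η m ν A : ℕ} (hη : 1 ≤ η) (hν : ν ≤ m)
    (hA : A ≤ p ^ (m - ν)) {ij : ℕ × ℕ}
    (h : ij ∈ blockPairs (p ^ (m - ν)) (primPairs p η ν) (triangle η A)) :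
    ij.1 < p ^ m ∧ ij.2 < p ^ m := by
  rw [mem_blockPairs (triangle_lt hη hA), primPairs, Finset.mem_filter, Finset.mem_product,
    Finset.mem_range, Finset.mem_range] at h
  have hpow : p ^ m = p ^ ν * p ^ (m - ν) := by rw [← pow_add]; congr 1; omega
  rw [hpow]
  exact ⟨Nat.lt_mul_of_div_lt h.1.1.1 (Nat.zero_lt_of_lt (triangle_lt hη hA _ h.2).1),
    Nat.lt_mul_of_div_lt h.1.1.2 (Nat.zero_lt_of_lt (triangle_lt hη hA _ h.2).1)⟩

theorem biUnion_blockPairs {p η : ℕ} (hη : 1 ≤ η) (m : ℕ) :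
    (Finset.range (m + 1)).biUnion (fun ν =>
      blockPairs (p ^ (m - ν)) (primPairs p η ν) (triangle η (p ^ (m - ν)))) =
    Finset.range (p ^ m) ×ˢ Finset.range (p ^ m) := by
  ext ⟨i, j⟩
  simp only [Finset.mem_biUnion, Finset.mem_range, Finset.mem_product]
  constructor
  · rintro ⟨ν, hν, h⟩
    exact blockPairs_subset hη (by omega) le_rfl h
  · rintro ⟨hi, hj⟩
    -- The block is found from the largest `k` whose low `k` digits lie in the triangle; `k = 0`
    -- always qualifies.
    set P : ℕ → Prop := fun k => i % p ^ k + η * (j % p ^ k) < p ^ k with hP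
    have hk := Nat.findGreatest_spec (P := P) (m := 0) (n := m) (Nat.zero_le _)
      (by simp [hP, Nat.mod_one])
    have hkm : Nat.findGreatest P m ≤ m := Nat.findGreatest_le m
    have hmax : ∀ k', Nat.findGreatest P m < k' → k' ≤ m → ¬ P k' :=
      fun k' h1 h2 => Nat.findGreatest_is_greatest h1 h2
    set k := Nat.findGreatest P m
    refine ⟨m - k, by omega, ?_⟩
    have hmk : m - (m - k) = k := by omega
    rw [hmk, mem_blockPairs (triangle_lt hη le_rfl), mem_triangle hη]
    refine ⟨?_, hk⟩
    have hpow : p ^ m = p ^ k * p ^ (m - k) := by rw [← pow_add]; congr 1; omega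
    rw [primPairs, Finset.mem_filter, Finset.mem_product, Finset.mem_range, Finset.mem_range]
    refine ⟨⟨Nat.div_lt_of_lt_mul (hpow ▸ hi), Nat.div_lt_of_lt_mul (hpow ▸ hj)⟩, ?_⟩
    intro k' hk'
    rw [Finset.mem_Icc] at hk'
    by_contra hlt
    push Not at hlt
    refine hmax (k + k') (by omega) (by omega) ?_
    simp only [hP] at hk ⊢
    simp only at hlt
    rw [pow_add, Nat.mod_mul, Nat.mod_mul]
    -- By integrality a strict inequality for the high digits leaves room `p^k` for the low part,
    -- contradicting maximality.
    have h3 := Nat.mul_le_mul_left (p ^ k) (Nat.succ_le_of_lt hlt)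
    have h5 : η * (j % p ^ k + p ^ k * (j / p ^ k % p ^ k')) =
      η * (j % p ^ k) + p ^ k * (η * (j / p ^ k % p ^ k')) := by ring
    rw [h5]
    rw [Nat.succ_eq_add_one, mul_add, mul_add, mul_one] at h3
    omega

theorem sum_card_primPairs_mul {p η : ℕ} (hη : 1 ≤ η) (m : ℕ) :
    ∑ ν ∈ Finset.range (m + 1), (primPairs p η ν).card * (triangle η (p ^ (m - ν))).card =
      p ^ (2 * m) := by
  have h := congrArg Finset.card (biUnion_blockPairs (p := p) hη m)
  rw [Finset.card_biUnion (pairwiseDisjoint_blockPairs hη _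
    (fun ν hν => by rw [Finset.mem_range] at hν; omega) (fun ν => p ^ (m - ν))
    fun ν => le_rfl), Finset.card_product, Finset.card_range] at h
  rw [two_mul, pow_add, ← h]
  exact Finset.sum_congr rfl fun ν _ => (card_blockPairs (triangle_lt hη le_rfl)).symm

theorem card_triangle {η A : ℕ} (hη : 1 ≤ η) (hA : 1 ≤ A) :
    ((triangle η A).card : ℝ) =
      (((A - 1) / η : ℕ) + 1) * ((A : ℝ) - (η : ℝ) / 2 * ((A - 1) / η : ℕ)) := by
  have h1 : (triangle η A).card = ∑ v ∈ Finset.range ((A - 1) / η + 1), (A - η * v) := by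
    have : triangle η A = (Finset.range ((A - 1) / η + 1)).biUnion fun v =>
        (Finset.range (A - η * v)).image fun u => (u, v) := by
      ext ⟨u, v⟩
      rw [mem_triangle hη]
      simp only [Finset.mem_biUnion, Finset.mem_range, Finset.mem_image, Prod.mk.injEq]
      constructor
      · intro h
        refine ⟨v, ?_, u, by omega, rfl, rfl⟩
        rw [Nat.lt_succ_iff, Nat.le_div_iff_mul_le hη, mul_comm]
        omega
      · rintro ⟨v', -, u', h, rfl, rfl⟩
        omega
    rw [this, Finset.card_biUnion]
    · refine Finset.sum_congr rfl fun v _ => ?_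
      rw [Finset.card_image_of_injective _ fun _ _ h => (Prod.ext_iff.1 h).1, Finset.card_range]
    · intro v _ v' _ hne
      refine Finset.disjoint_left.2 fun z hz hz' => hne ?_
      obtain ⟨u, -, rfl⟩ := Finset.mem_image.1 hz
      obtain ⟨u', -, h⟩ := Finset.mem_image.1 hz'
      exact (Prod.ext_iff.1 h).2.symm
  have h2 : ∀ v ∈ Finset.range ((A - 1) / η + 1), ((A - η * v : ℕ) : ℝ) = A - η * v := by
    intro v hv
    rw [Finset.mem_range, Nat.lt_succ_iff, Nat.le_div_iff_mul_le hη, mul_comm] at hv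
    rw [Nat.cast_sub (by omega)]
    push_cast
    ring
  have h3 : ∀ n : ℕ, ∑ v ∈ Finset.range (n + 1), ((A : ℝ) - η * v) =
      (n + 1) * (A - η / 2 * n) := by
    intro n
    induction n with
    | zero => simp
    | succ n ih => rw [Finset.sum_range_succ, ih]; push_cast; ring
  rw [h1, Nat.cast_sum, Finset.sum_congr rfl h2, h3]

theorem card_triangle_ge {η A : ℕ} (hη : 1 ≤ η) (hA : 1 ≤ A) :
    ((A : ℝ) - 1) ^ 2 / (2 * η) ≤ (triangle η A).card := by
  rw [card_triangle hη hA]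
  set V := (A - 1) / η with hV
  -- Writing `A - 1 = η V + r` removes the floor; what remains is a polynomial inequality between
  -- the lattice count and the area of a real triangle.
  obtain ⟨r, hr, hAr⟩ : ∃ r, r < η ∧ A = η * V + r + 1 :=
    ⟨(A - 1) % η, Nat.mod_lt _ hη, by rw [hV, Nat.div_add_mod]; omega⟩
  have hη0 : (0 : ℝ) < η := by exact_mod_cast hη
  have hr' : (r : ℝ) ≤ η := by exact_mod_cast hr.le
  have hV0 : (0 : ℝ) ≤ V := Nat.cast_nonneg _
  have hr0 : (0 : ℝ) ≤ r := Nat.cast_nonneg _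
  rw [hAr, div_le_iff₀ (by positivity)]
  push_cast
  nlinarith [mul_nonneg hr0 (sub_nonneg.2 hr'), mul_nonneg hη0.le hV0,
    mul_nonneg hη0.le (mul_nonneg hη0.le hV0), mul_nonneg hη0.le hr0]

theorem seqT_eq_card {p η : ℕ} (hp : p.Prime) (hη : 1 ≤ η) (m : ℕ) :
    seqT p η m = (triangle η (p ^ m)).card := by
  rw [card_triangle hη (Nat.one_le_pow _ _ hp.pos), seqT, Nat.cast_pow]

/-- The partition into blocks satisfies the defining recursion, its last term being isolated by `T_0
= 1`. In particular the numbers `N_m` are nonnegative. -/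
theorem seqN_eq_card {p η : ℕ} (hp : p.Prime) (hη : 1 ≤ η) (m : ℕ) :
    seqN p η m = (primPairs p η m).card := by
  induction m using Nat.strong_induction_on with
  | _ m ih =>
    have h := sum_card_primPairs_mul (p := p) hη m
    have h1 : (triangle η (p ^ 0)).card = 1 := by
      have := card_triangle hη (le_refl 1)
      rw [pow_zero]
      simpa using this
    rw [Finset.sum_range_succ, Nat.sub_self, h1, mul_one] at h
    have h' : (∑ ν ∈ Finset.range m, ((primPairs p η ν).card : ℝ) *
        (triangle η (p ^ (m - ν))).card) + (primPairs p η m).card = (p : ℝ) ^ (2 * m) := by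
      exact_mod_cast h
    cases m with
    | zero => rw [seqN]; simpa using h'.symm
    | succ m =>
      rw [seqN, ← h', Finset.sum_range]
      have h2 : ∀ ν ∈ (Finset.univ : Finset (Fin (m + 1))),
          seqN p η ν.1 * seqT p η (m + 1 - ν.1) =
            (primPairs p η ν.1).card * (triangle η (p ^ (m + 1 - ν.1))).card :=
        fun ν _ => by rw [ih ν.1 ν.2, seqT_eq_card hp hη]
      rw [Finset.sum_congr rfl h2]
      ring

/-- The triangle with side `p^(e-ε)` is shrunk by `p^(e-c)`, the gap between `q` and the degree
bound, and by `η` for the wraps modulo `q`. -/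
theorem card_goodExps_ge {p η c e : ℕ} (hp : p.Prime) (hη : 1 ≤ η) (hce : c ≤ e) :
    ∑ ε ∈ Finset.range c,
      (primPairs p η ε).card * (triangle η (p ^ (e - ε) - p ^ (e - c) - η)).card ≤
    (goodExps p η (p ^ e) (p ^ e - p ^ (e - c))).card := by
  have hA : ∀ ε, p ^ (e - ε) - p ^ (e - c) - η ≤ p ^ (e - ε) := fun ε => by omega
  have h : (Finset.range c).biUnion (fun ε => blockPairs (p ^ (e - ε)) (primPairs p η ε)
      (triangle η (p ^ (e - ε) - p ^ (e - c) - η))) ⊆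
      goodExps p η (p ^ e) (p ^ e - p ^ (e - c)) := by
    intro ij hij
    rw [Finset.mem_biUnion] at hij
    obtain ⟨ε, hε, h⟩ := hij
    rw [Finset.mem_range] at hε
    have hlt := blockPairs_subset hη (by omega) (hA ε) h
    refine mem_goodExps.2 ⟨hlt, ?_⟩
    rw [mem_blockPairs (triangle_lt hη (hA ε)), mem_triangle hη] at h
    refine isGoodExp_of_low_digits (m := e - ε) hp (by omega) (Nat.one_le_pow _ _ hp.pos)
      hlt.1 hlt.2 ?_
    have h1 := h.2
    simp only at h1
    have h2 := Nat.zero_le (ij.1 % p ^ (e - ε))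
    omega
  have := Finset.card_le_card h
  rwa [Finset.card_biUnion (pairwiseDisjoint_blockPairs hη _
    (fun ν hν => by rw [Finset.mem_range] at hν; omega) _ hA),
    Finset.sum_congr rfl fun ε _ => card_blockPairs (triangle_lt hη (hA ε))] at this

/-! ### Convergence of the rate -/

/-- The new digit goes into slot `0`, which has weight zero, so appending it only multiplies the
exponent weight by `p`. -/
theorem CarryFree.mul_add_single {η p b : ℕ} {l : Fin (η + 1) → ℕ} (h : CarryFree p l)
    (hb : b < p) : CarryFree p fun k => p * l k + (Pi.single 0 b : Fin (η + 1) → ℕ) k := by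
  intro m
  cases m with
  | zero => simp [Nat.mod_one]
  | succ m =>
    have h1 : ∀ k, (p * l k + (Pi.single 0 b : Fin (η + 1) → ℕ) k) % p ^ (m + 1) =
        p * (l k % p ^ m) + (Pi.single 0 b : Fin (η + 1) → ℕ) k := by
      intro k
      have hk : (Pi.single 0 b : Fin (η + 1) → ℕ) k < p := by
        rcases eq_or_ne k 0 with rfl | hk
        · simpa using hb
        · simpa [hk] using Nat.zero_lt_of_lt hb
      rw [pow_succ', Nat.mod_mul, Nat.mul_add_mod, Nat.mod_eq_of_lt hk,
        Nat.mul_add_div (by omega), Nat.div_eq_of_lt hk, add_zero, add_comm]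
    have h2 := Nat.mul_le_mul_left p (Nat.succ_le_of_lt (h m))
    rw [Finset.sum_congr rfl fun k _ => h1 k, Finset.sum_add_distrib, ← Finset.mul_sum, pow_succ']
    simp only [Finset.sum_pi_single', Finset.mem_univ, if_true]
    rw [Nat.succ_eq_add_one, mul_add, mul_one] at h2
    have h3 : ∑ k, (Pi.single 0 b : Fin (η + 1) → ℕ) k = b := by simp
    omega

theorem expWeight_mul_add_single {η p b : ℕ} (l : Fin (η + 1) → ℕ) :
    expWeight (fun k => p * l k + (Pi.single 0 b : Fin (η + 1) → ℕ) k) = p * expWeight l := by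
  rw [expWeight, expWeight, Finset.mul_sum]
  refine Finset.sum_congr rfl fun k _ => ?_
  rcases eq_or_ne k 0 with rfl | hk
  · simp
  · simp [hk]; ring

/-- Moving `p^t` between slots changes no residue modulo `p^m` for `m ≤ t`. For `m > t` the donor's
residue drops by `p^t` without a borrow and the receiver's rises by at most that, so the sum of
residues does not grow. -/
theorem CarryFree.shift {κ : Type*} [Fintype κ] [DecidableEq κ] {p t : ℕ} {l l' : κ → ℕ}
    (h : CarryFree p l) {k k' : κ}
    (hl' : ∀ x, l' x + (if x = k then p ^ t else 0) = l x + (if x = k' then p ^ t else 0))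
    (hkk' : k ≠ k') (hk : ∀ m, t < m → p ^ t ≤ l k % p ^ m) : CarryFree p l' := by
  intro m
  rcases le_or_gt m t with hm | hm
  · have h1 : ∀ x, l' x % p ^ m = l x % p ^ m := by
      intro x
      have h2 : ∀ P : Prop, ∀ _ : Decidable P, (if P then p ^ t else 0) ≡ 0 [MOD p ^ m] := by
        intro P _
        split_ifs
        · exact (Nat.modEq_zero_iff_dvd).2 (pow_dvd_pow p hm)
        · rfl
      have h3 : l' x + (if x = k then p ^ t else 0) ≡ l x + 0 [MOD p ^ m] := by
        rw [hl' x]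
        exact Nat.ModEq.add_left _ (h2 _ _)
      exact (Nat.ModEq.add_left _ (h2 _ _)).symm.trans h3
    rw [Finset.sum_congr rfl fun x _ => h1 x]
    exact h m
  · have h1 : ∀ x, l' x % p ^ m + (if x = k then p ^ t else 0) ≤
        l x % p ^ m + (if x = k' then p ^ t else 0) := by
      intro x
      have hx := hl' x
      by_cases hxk : x = k
      · subst hxk
        rw [if_pos rfl, if_neg hkk'] at hx ⊢
        have h2 := Nat.div_add_mod (l x) (p ^ m)
        have h3 := hk m hm
        have h4 : l' x = p ^ m * (l x / p ^ m) + (l x % p ^ m - p ^ t) := by omega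
        rw [h4, Nat.mul_add_mod, Nat.mod_eq_of_lt]
        · omega
        · have : l x % p ^ m < p ^ m := Nat.mod_lt _ (Nat.pos_of_ne_zero fun h0 => by
            have := h m; omega)
          omega
      · rw [if_neg hxk, add_zero] at hx ⊢
        rw [hx, Nat.add_mod]
        exact (Nat.mod_le _ _).trans (Nat.add_le_add_left (Nat.mod_le _ _) _)
    have h2 := Finset.sum_le_sum fun x (_ : x ∈ Finset.univ) => h1 x
    simp only [Finset.sum_add_distrib, Finset.sum_ite_eq', Finset.mem_univ, if_true] at h2
    have := h m
    omega

/-- At the least `m` for which the residue modulo `p^m` reaches `p^s`, the digit in position `m - 1`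
is nonzero; take `t = m - 1`. -/
theorem exists_low_digit {p x s n : ℕ} (hp : p.Prime) (h : p ^ s ≤ x % p ^ n) :
    ∃ t, s ≤ t ∧ t < n ∧ ∀ m, t < m → p ^ t ≤ x % p ^ m := by
  classical
  have hex : ∃ m, p ^ s ≤ x % p ^ m := ⟨n, h⟩
  have hspec := Nat.find_spec hex
  have hmin : ∀ m, m < Nat.find hex → ¬ p ^ s ≤ x % p ^ m := fun m hm => Nat.find_min hex hm
  have hle : Nat.find hex ≤ n := Nat.find_min' hex h
  set m₀ := Nat.find hex
  have hs : s < m₀ := by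
    by_contra hcon
    have h1 : x % p ^ m₀ < p ^ m₀ := Nat.mod_lt _ (pow_pos hp.pos _)
    have h2 := Nat.pow_le_pow_right hp.pos (not_lt.1 hcon)
    omega
  obtain ⟨t, ht⟩ : ∃ t, m₀ = t + 1 := ⟨m₀ - 1, by omega⟩
  refine ⟨t, by omega, by omega, fun m hm => ?_⟩
  have h1 := hmin t (by omega)
  rw [ht, pow_succ, Nat.mod_mul] at hspec
  have h2 : 1 ≤ x / p ^ t % p := by
    by_contra h0
    rw [Nat.lt_one_iff.1 (not_le.1 h0), mul_zero, add_zero] at hspec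
    exact h1 hspec
  have h3 : x % p ^ (t + 1) ≤ x % p ^ m := by
    rw [← Nat.mod_mod_of_dvd x (pow_dvd_pow p hm)]
    exact Nat.mod_le _ _
  have h4 := Nat.mul_le_mul_left (p ^ t) h2
  rw [pow_succ, Nat.mod_mul] at h3
  have h5 := Nat.zero_le (x % p ^ t)
  omega

/-- A witness of badness that persists when digits are appended. -/
def HasStableWitness (p η q N i j : ℕ) : Prop :=
  ∃ l : Fin (η + 1) → ℕ, CarryFree p l ∧ ∑ k, l k = j ∧
    q < (i + expWeight l) % q + N ∧ (i + expWeight l) % q + (i + expWeight l) / q < q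

/-- The exponent `S = M q + r` becomes `p S + a = M (p q) + (p r + a)`: the quotient stays while the
residue and both bounds scale by `p`. -/
theorem HasStableWitness.not_isGoodExp {p η q N i j a b : ℕ}
    (h : HasStableWitness p η q N i j) (ha : a < p) (hb : b < p) (hN : N ≤ q) :
    ¬ IsGoodExp p η (p * q) (p * q - p * N) (p * i + a) (p * j + b) := by
  obtain ⟨l, hcf, hl, h1, h2⟩ := h
  intro hgood
  have h3 := hgood _ (hcf.mul_add_single hb) (by
    rw [Finset.sum_add_distrib, ← Finset.mul_sum, hl]
    simp)
  rw [expWeight_mul_add_single] at h3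
  set S := i + expWeight l with hS
  have hdm := Nat.div_add_mod' S q
  set M := S / q
  set r := S % q
  have hp : 0 < p := by omega
  have h4 := Nat.mul_le_mul_left p (Nat.succ_le_of_lt h2)
  have h5 := Nat.mul_le_mul_left p (Nat.succ_le_of_lt h1)
  have h6 := Nat.mul_le_mul_left p hN
  have h7 : M ≤ p * M := Nat.le_mul_of_pos_left _ hp
  simp only [Nat.succ_eq_add_one, mul_add, mul_one] at h4 h5
  have h8 := Nat.zero_le M
  rw [redExp_of_eq (M := M) (r := p * r + a)] at h3
  · omega
  · calc p * i + a + p * expWeight l = p * S + a := by rw [hS]; ring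
      _ = M * (p * q) + (p * r + a) := by rw [← hdm]; ring
  · omega

theorem hasStableWitness_or {p η c e i j : ℕ} (hp : p.Prime) (hc : 1 ≤ c) (he : η + c + 1 ≤ e)
    (hi : i < p ^ e) (hj : j < p ^ e)
    (hbad : ¬ IsGoodExp p η (p ^ e) (p ^ e - p ^ (e - c)) i j) :
    HasStableWitness p η (p ^ e) (p ^ (e - c)) i j ∨
      (i + (η * j + η)) % p ^ (e - c) < η + (η + 1) * (η * p ^ η) + 1 := by
  classical
  simp only [IsGoodExp, not_forall, not_le] at hbad
  obtain ⟨l, hcf, hl, hlt⟩ := hbad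
  have hM := add_expWeight_div_le hi (hl.symm ▸ hj : ∑ k, l k < p ^ e)
  have hNq : p ^ (e - c) ≤ p ^ e := Nat.pow_le_pow_right hp.pos (by omega)
  have hηlt : η < p ^ η := Nat.lt_pow_self hp.one_lt
  have hN2 : ∀ t, t < e - c → 2 * p ^ t ≤ p ^ (e - c) := fun t ht =>
    calc 2 * p ^ t ≤ p * p ^ t := Nat.mul_le_mul_right _ hp.two_le
      _ = p ^ (t + 1) := (pow_succ' _ _).symm
      _ ≤ p ^ (e - c) := Nat.pow_le_pow_right hp.pos ht
  have hη2 := hN2 η (by omega)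
  have hdvd : p ^ (e - c) ∣ p ^ e := pow_dvd_pow p (by omega)
  by_cases hw : HasStableWitness p η (p ^ e) (p ^ (e - c)) i j
  · exact Or.inl hw
  right
  set N := p ^ (e - c) with hN
  set q := p ^ e with hq
  set S := i + expWeight l with hS
  have hdm := Nat.div_add_mod' S q
  have hrq : S % q < q := Nat.mod_lt _ (pow_pos hp.pos e)
  have hqN : 2 * N ≤ q :=
    calc 2 * N ≤ p * N := Nat.mul_le_mul_right _ hp.two_le
      _ = p ^ (e - c + 1) := (pow_succ' _ _).symm
      _ ≤ q := Nat.pow_le_pow_right hp.pos (by omega)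
  -- A second wrap would reduce the exponent to at most `η < N ≤ q - N`, which is not bad.
  have hsum : S % q + S / q < q := by
    by_contra hge
    have h1 : redExp q S = S % q + S / q - (q - 1) := by
      refine redExp_eq_of_eq (M := S / q + 1) ?_ (by omega) (by omega)
      conv_lhs => rw [← hdm]
      obtain ⟨q', hq'⟩ : ∃ q', q = q' + 1 := ⟨q - 1, by omega⟩
      generalize S / q = M at *
      generalize S % q = r at *
      rw [hq', Nat.add_sub_cancel, add_mul, one_mul, mul_add, mul_one]
      omega
    omega
  rw [redExp_of_eq hdm.symm hsum] at hlt
  have hrN : S % q + N ≤ q := by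
    by_contra h
    exact hw ⟨l, hcf, hl, not_le.1 h, hsum⟩
  -- Otherwise `l k` has a nonzero digit at some position `t` with `η ≤ t < e - c`. Moving `p^t` to
  -- slot `k + 1` raises the exponent by `p^t`: since `η < p^t`, the residue enters the top window,
  -- and since `p^t ≤ N/2` and `η < N/2`, it does not wrap. That would be a stable witness.
  have hlow : ∀ k : Fin (η + 1), (k : ℕ) < η → l k % N < p ^ η := by
    intro k hkη
    by_contra hk
    obtain ⟨t, hηt, htN, hdig⟩ := exists_low_digit hp (not_lt.1 hk)
    have ht2 := hN2 t htN
    have htη : p ^ η ≤ p ^ t := Nat.pow_le_pow_right hp.pos hηt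
    have hlk : p ^ t ≤ l k := (hdig (t + 1) (by omega)).trans (Nat.mod_le _ _)
    set k' : Fin (η + 1) := ⟨k + 1, by omega⟩ with hk'
    have hne : k ≠ k' := by
      intro h
      have := congrArg Fin.val h
      simp [hk'] at this
    set l' : Fin (η + 1) → ℕ := fun x =>
      l x + (if x = k' then p ^ t else 0) - (if x = k then p ^ t else 0)
    have hl' : ∀ x, l' x + (if x = k then p ^ t else 0) =
        l x + (if x = k' then p ^ t else 0) := by
      intro x
      refine Nat.sub_add_cancel ?_
      split_ifs with h1 h2
      · omega
      · rw [h1]; omega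
      · omega
      · omega
    have hsum' : ∑ x, l' x = j := by
      have h1 := Finset.sum_congr rfl fun x (_ : x ∈ Finset.univ) => hl' x
      simp only [Finset.sum_add_distrib, Finset.sum_ite_eq', Finset.mem_univ, if_true] at h1
      omega
    have hwt : expWeight l' = expWeight l + p ^ t := by
      have h1 := Finset.sum_congr rfl fun (x : Fin (η + 1)) (_ : x ∈ Finset.univ) =>
        congrArg (fun y => (x : ℕ) * y) (hl' x)
      simp only [mul_add, Finset.sum_add_distrib, mul_ite, mul_zero, Finset.sum_ite_eq',
        Finset.mem_univ, if_true] at h1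
      change expWeight l' + _ = expWeight l + _ at h1
      have h2 : (k' : ℕ) = k + 1 := rfl
      rw [h2, add_mul, one_mul] at h1
      omega
    refine hw ⟨l', hcf.shift hl' hne hdig, hsum', ?_⟩
    have h1 : i + expWeight l' = S / q * q + (S % q + p ^ t) := by
      rw [hwt]; omega
    have h2 : S % q + p ^ t < q := by omega
    have h3 : (i + expWeight l') % q = S % q + p ^ t := by
      rw [h1, Nat.mul_add_mod', Nat.mod_eq_of_lt h2]
    have h4 : (i + expWeight l') / q = S / q := by
      rw [h1, mul_comm, Nat.mul_add_div (by omega), Nat.div_eq_of_lt h2, add_zero]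
    rw [h3, h4]
    omega
  have hZ : ∑ k : Fin (η + 1), (η - (k : ℕ)) * (l k % N) ≤ (η + 1) * (η * p ^ η) := by
    have h1 : ∀ k ∈ (Finset.univ : Finset (Fin (η + 1))),
        (η - (k : ℕ)) * (l k % N) ≤ η * p ^ η := by
      intro k _
      rcases lt_or_ge (k : ℕ) η with hk | hk
      · exact Nat.mul_le_mul (Nat.sub_le _ _) (hlow k hk).le
      · rw [Nat.sub_eq_zero_of_le hk, zero_mul]
        exact Nat.zero_le _
    simpa using Finset.sum_le_card_nsmul _ _ _ h1
  -- Now `S % q` lies within `η` below `q - N`, and `η j` differs from the weight by `∑ (η - k) l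
  -- k`, which is bounded modulo `N`.
  have hcomp : i + (η * j + η) = S + η + ∑ k : Fin (η + 1), (η - (k : ℕ)) * l k := by
    have h1 : η * j = expWeight l + ∑ k : Fin (η + 1), (η - (k : ℕ)) * l k := by
      rw [← hl, Finset.mul_sum, expWeight, ← Finset.sum_add_distrib]
      refine Finset.sum_congr rfl fun k _ => ?_
      rw [← add_mul, Nat.add_sub_cancel' (by omega)]
    rw [h1]
    omega
  have hS0 : S ≡ S % q [MOD N] := ((Nat.mod_modEq S q).of_dvd hdvd).symm
  have hy : S % q + η ≡ S % q + η + N - q [MOD N] := by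
    have h1 : S % q + η + N = (S % q + η + N - q) + q := by omega
    have h2 : S % q + η + N ≡ S % q + η [MOD N] := by simp [Nat.ModEq]
    have h3 : (S % q + η + N - q) + q ≡ (S % q + η + N - q) + 0 [MOD N] :=
      Nat.ModEq.add_left _ ((Nat.modEq_zero_iff_dvd).2 hdvd)
    exact h2.symm.trans ((congrArg (· % N) h1).trans h3)
  have hfin : i + (η * j + η) ≡
      (S % q + η + N - q) + ∑ k : Fin (η + 1), (η - (k : ℕ)) * (l k % N) [MOD N] := by
    rw [hcomp]
    refine Nat.ModEq.add ((hS0.add_right η).trans hy) ?_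
    exact Nat.ModEq.sum fun k _ => Nat.ModEq.mul_left _ (Nat.mod_modEq _ _).symm
  have h1 := hfin.trans_le (Nat.mod_le _ _)
  omega

theorem card_filter_mod_lt_le (N Q K : ℕ) (g : ℕ → ℕ) :
    ({ij ∈ Finset.range (N * Q) ×ˢ Finset.range (N * Q) | (ij.1 + g ij.2) % N < K}).card ≤
      N * Q * (Q * K) := by
  have := Finset.card_le_card_of_injOn
    (s := {ij ∈ Finset.range (N * Q) ×ˢ Finset.range (N * Q) | (ij.1 + g ij.2) % N < K})
    (t := Finset.range (N * Q) ×ˢ (Finset.range Q ×ˢ Finset.range K))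
    (fun ij => (ij.2, ij.1 / N, (ij.1 + g ij.2) % N))
    (by
      intro ij hij
      simp only [Finset.coe_filter, Finset.mem_product, Finset.mem_range, Set.mem_ofPred_eq] at hij
      simp only [Finset.coe_product, Finset.coe_range, Set.mem_prod, Set.mem_Iio]
      exact ⟨hij.1.2, Nat.div_lt_of_lt_mul hij.1.1, hij.2⟩)
    (by
      rintro ⟨i, j⟩ _ ⟨i', j'⟩ _ h
      simp only [Prod.mk.injEq] at h ⊢
      obtain ⟨rfl, h1, h2⟩ := h
      have h3 : i % N = i' % N := Nat.ModEq.add_right_cancel' (g j) h2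
      refine ⟨?_, rfl⟩
      rw [← Nat.div_add_mod i N, ← Nat.div_add_mod i' N, h1, h3])
  simpa using this

open Classical in
/-- The exponents below `q` that are not good. -/
noncomputable def badExps (p η q d : ℕ) : Finset (ℕ × ℕ) :=
  {ij ∈ Finset.range q ×ˢ Finset.range q | ¬ IsGoodExp p η q d ij.1 ij.2}

theorem card_goodExps_add_card_badExps (p η q d : ℕ) :
    (goodExps p η q d).card + (badExps p η q d).card = q ^ 2 := by
  classical
  have := Finset.card_filter_add_card_filter_not (s := Finset.range q ×ˢ Finset.range q)
    (fun ij : ℕ × ℕ => IsGoodExp p η q d ij.1 ij.2)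
  rw [Finset.card_product, Finset.card_range, ← sq] at this
  exact this

/-- Each pair with a stable witness has `p^2` bad extensions by one digit; the remaining bad pairs
lie in boundedly many classes of `i + η j + η` modulo `N`. -/
theorem card_badExps_succ {p η c e : ℕ} (hp : p.Prime) (hc : 1 ≤ c) (he : η + c + 1 ≤ e) :
    p ^ 2 * (badExps p η (p ^ e) (p ^ e - p ^ (e - c))).card ≤
      (badExps p η (p ^ (e + 1)) (p ^ (e + 1) - p ^ (e + 1 - c))).card +
        p ^ 2 * (p ^ e * (p ^ c * (η + (η + 1) * (η * p ^ η) + 1))) := by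
  classical
  set q := p ^ e with hq
  set N := p ^ (e - c) with hN
  set K := η + (η + 1) * (η * p ^ η) + 1 with hK
  have hqN : q = N * p ^ c := by rw [hq, hN, ← pow_add]; congr 1; omega
  have hNq : N ≤ q := Nat.pow_le_pow_right hp.pos (by omega)
  set s : Finset (ℕ × ℕ) :=
    {ij ∈ Finset.range q ×ˢ Finset.range q | HasStableWitness p η q N ij.1 ij.2} with hs
  have h1 : (badExps p η q (q - N)).card ≤ s.card + q * (p ^ c * K) := by
    have h2 : badExps p η q (q - N) ⊆ s ∪
        {ij ∈ Finset.range q ×ˢ Finset.range q | (ij.1 + (η * ij.2 + η)) % N < K} := by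
      intro ij hij
      simp only [badExps, Finset.mem_filter, Finset.mem_product, Finset.mem_range] at hij
      simp only [hs, Finset.mem_union, Finset.mem_filter, Finset.mem_product, Finset.mem_range]
      rcases hasStableWitness_or hp hc he hij.1.1 hij.1.2 hij.2 with h | h
      · exact Or.inl ⟨hij.1, h⟩
      · exact Or.inr ⟨hij.1, h⟩
    have h3 := card_filter_mod_lt_le N (p ^ c) K fun j => η * j + η
    rw [← hqN] at h3
    exact (Finset.card_le_card h2).trans ((Finset.card_union_le _ _).trans
      (Nat.add_le_add_left h3 _))
  have hZ : ∀ z ∈ Finset.range p ×ˢ Finset.range p, z.1 < p ∧ z.2 < p := by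
    intro z hz
    simpa using hz
  have h4 : s.card * p ^ 2 ≤ (badExps p η (p ^ (e + 1)) (p ^ (e + 1) - p ^ (e + 1 - c))).card := by
    have h5 := card_blockPairs (N := s) hZ
    rw [Finset.card_product, Finset.card_range, ← sq] at h5
    rw [← h5]
    refine Finset.card_le_card fun ij hij => ?_
    rw [mem_blockPairs hZ, hs, Finset.mem_filter, Finset.mem_product, Finset.mem_product] at hij
    simp only [Finset.mem_range] at hij
    obtain ⟨⟨⟨hi, hj⟩, hw⟩, ha, hb⟩ := hij
    have h6 := hw.not_isGoodExp ha hb hNq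
    rw [Nat.div_add_mod, Nat.div_add_mod] at h6
    have h7 : p ^ (e + 1) = p * q := pow_succ' _ _
    have h8 : p ^ (e + 1 - c) = p * N := by
      rw [hN, ← pow_succ']; congr 1; omega
    simp only [badExps, Finset.mem_filter, Finset.mem_product, Finset.mem_range]
    rw [h7, h8]
    refine ⟨⟨?_, ?_⟩, h6⟩
    · rw [mul_comm]; exact Nat.lt_mul_of_div_lt hi hp.pos
    · rw [mul_comm]; exact Nat.lt_mul_of_div_lt hj hp.pos
  have h9 := Nat.mul_le_mul_left (p ^ 2) h1
  rw [mul_add, mul_comm _ s.card] at h9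
  omega

theorem exists_tendsto_of_almost_monotone {x : ℕ → ℝ} {p K B : ℝ} (hp : 2 ≤ p) (hK : 0 ≤ K)
    (hB : ∀ e, x e ≤ B) (e₀ : ℕ) (h : ∀ e, e₀ ≤ e → x e ≤ x (e + 1) + K * (p ^ e)⁻¹) :
    ∃ R, Tendsto x atTop (𝓝 R) := by
  have hp0 : 0 < p := by linarith
  -- Subtracting `2 K p^(-e)` absorbs the error: for `p ≥ 2` this term falls by at least `K p^(-e)`
  -- at each step.
  set z : ℕ → ℝ := fun e => x (e + e₀) - 2 * K * (p ^ (e + e₀))⁻¹ with hz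
  have hmono : Monotone z := by
    refine monotone_nat_of_le_succ fun e => ?_
    have h1 := h (e + e₀) (by omega)
    have h2 : (p ^ (e + 1 + e₀))⁻¹ = (p ^ (e + e₀))⁻¹ * p⁻¹ := by
      rw [← mul_inv, ← pow_succ]; congr 2; omega
    have h3 : p⁻¹ ≤ 1 / 2 := by
      rw [inv_le_comm₀ hp0 (by norm_num)]; linarith
    have h4 : 0 ≤ K * (p ^ (e + e₀))⁻¹ := by positivity
    have h5 : e + 1 + e₀ = e + e₀ + 1 := by omega
    simp only [hz]
    rw [h2, h5]
    nlinarith [mul_le_mul_of_nonneg_left h3 h4]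
  have hbdd : BddAbove (Set.range z) := by
    refine ⟨B, ?_⟩
    rintro _ ⟨e, rfl⟩
    have h4 : 0 ≤ 2 * K * (p ^ (e + e₀))⁻¹ := by positivity
    have := hB (e + e₀)
    simp only [hz]
    linarith
  have h1 := tendsto_atTop_ciSup hmono hbdd
  refine ⟨⨆ e, z e, ?_⟩
  rw [← tendsto_add_atTop_iff_nat e₀]
  have h2 : Tendsto (fun e : ℕ => 2 * K * (p ^ (e + e₀))⁻¹) atTop (𝓝 0) := by
    have h3 : Tendsto (fun e : ℕ => (p ^ e)⁻¹) atTop (𝓝 0) :=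
      (tendsto_pow_atTop_atTop_of_one_lt (by linarith)).inv_tendsto_atTop
    have := ((tendsto_add_atTop_iff_nat e₀).2 h3).const_mul (2 * K)
    simpa using this
  have h3 := h1.add h2
  simpa [hz] using h3

theorem exists_tendsto_card_goodExps {p η c : ℕ} (hp : p.Prime) (hc : 1 ≤ c) :
    ∃ R : ℝ, Tendsto (fun e => ((goodExps p η (p ^ e) (p ^ e - p ^ (e - c))).card : ℝ) /
      ((p : ℝ) ^ e) ^ 2) atTop (𝓝 R) := by
  have hp0 : (0 : ℝ) < p := by exact_mod_cast hp.pos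
  set x : ℕ → ℝ := fun e => ((badExps p η (p ^ e) (p ^ e - p ^ (e - c))).card : ℝ) /
      ((p : ℝ) ^ e) ^ 2 with hx
  have hgx : ∀ e, ((goodExps p η (p ^ e) (p ^ e - p ^ (e - c))).card : ℝ) / ((p : ℝ) ^ e) ^ 2 =
      1 - x e := by
    intro e
    have h1 := card_goodExps_add_card_badExps p η (p ^ e) (p ^ e - p ^ (e - c))
    have h2 : ((goodExps p η (p ^ e) (p ^ e - p ^ (e - c))).card : ℝ) +
      (badExps p η (p ^ e) (p ^ e - p ^ (e - c))).card = ((p : ℝ) ^ e) ^ 2 := by exact_mod_cast h1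
    have h3 : ((p : ℝ) ^ e) ^ 2 ≠ 0 := by positivity
    simp only [hx]
    rw [eq_sub_iff_add_eq, ← add_div, h2, div_self h3]
  set K : ℕ := p ^ c * (η + (η + 1) * (η * p ^ η) + 1) with hK
  obtain ⟨R, hR⟩ := exists_tendsto_of_almost_monotone (x := x) (p := p) (K := K) (B := 1)
    (by exact_mod_cast hp.two_le) (Nat.cast_nonneg _)
    (by
      intro e
      have h1 := hgx e
      have h2 : 0 ≤ ((goodExps p η (p ^ e) (p ^ e - p ^ (e - c))).card : ℝ) /
        ((p : ℝ) ^ e) ^ 2 := by positivity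
      linarith) (η + c + 1)
    (by
      intro e he
      have h1 := card_badExps_succ (η := η) hp hc he
      have h2 : (p : ℝ) ^ 2 * (badExps p η (p ^ e) (p ^ e - p ^ (e - c))).card ≤
        (badExps p η (p ^ (e + 1)) (p ^ (e + 1) - p ^ (e + 1 - c))).card +
        (p : ℝ) ^ 2 * ((p : ℝ) ^ e * K) := by exact_mod_cast h1
      simp only [hx]
      have hpe : (0 : ℝ) < (p : ℝ) ^ e := by positivity
      have h3 : ((p : ℝ) ^ (e + 1)) ^ 2 = (p : ℝ) ^ 2 * ((p : ℝ) ^ e) ^ 2 := by ring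
      rw [h3]
      generalize ((badExps p η (p ^ e) (p ^ e - p ^ (e - c))).card : ℝ) = b at *
      generalize ((badExps p η (p ^ (e + 1)) (p ^ (e + 1) - p ^ (e + 1 - c))).card : ℝ) = b' at *
      generalize (p : ℝ) ^ e = y at *
      have h4 : b' / ((p : ℝ) ^ 2 * y ^ 2) + K * y⁻¹ =
          (b' + (p : ℝ) ^ 2 * (y * K)) / ((p : ℝ) ^ 2 * y ^ 2) := by
        field_simp
      have h5 : b / y ^ 2 = (p : ℝ) ^ 2 * b / ((p : ℝ) ^ 2 * y ^ 2) := by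
        field_simp
      rw [h4, h5]
      gcongr)
  refine ⟨1 - R, ?_⟩
  simp only [hgx]
  exact hR.const_sub 1

/-! ### Lines through a point -/

section

variable {F : Type*} [Field F]

/-- The line of slope `m` through the point `x`, parametrized by the first coordinate. -/
def linePt (x : Fin 2 → F) (m t : F) : Fin 2 → F := ![t, x 1 + m * (t - x 0)]

theorem linePt_self (x : Fin 2 → F) (m : F) : linePt x m (x 0) = x := by
  funext k
  fin_cases k <;> simp [linePt]

theorem exists_poly_on_line {η d : ℕ} (hη : 1 ≤ η) {v : (Fin 2 → F) → F}
    (hv : v ∈ liftRS F η d) (x : Fin 2 → F) (m : F) :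
    ∃ g : Polynomial F, g.natDegree ≤ d ∧ ∀ t, v (linePt x m t) = g.eval t := by
  obtain ⟨f, hf, rfl⟩ := (mem_liftRS F).1 hv
  have hdeg : (Polynomial.C (x 1) + Polynomial.C m * (Polynomial.X - Polynomial.C (x 0))).natDegree
      ≤ η := by
    refine le_trans ?_ hη
    compute_degree
  obtain ⟨g, hg, hgv⟩ := mem_RSCode_iff.1 (hf _ hdeg)
  refine ⟨g, hg, fun t => ?_⟩
  rw [← hgv t, eval_aeval_curve]
  simp [linePt]

theorem eq_of_eval_eq_of_lt_card {d : ℕ} {g h : Polynomial F} (hg : g.natDegree ≤ d)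
    (hh : h.natDegree ≤ d) (s : Finset F) (hs : d < s.card)
    (heq : ∀ t ∈ s, g.eval t = h.eval t) : g = h := by
  refine Polynomial.eq_of_degrees_lt_of_eval_finset_eq s ?_ ?_ heq
  · exact Polynomial.degree_le_natDegree.trans_lt (by exact_mod_cast hg.trans_lt hs)
  · exact Polynomial.degree_le_natDegree.trans_lt (by exact_mod_cast hh.trans_lt hs)

variable [Fintype F] [DecidableEq F]

/-- A point off the vertical line through `x` lies on exactly one line of finite slope through `x`,
so no point is counted twice. -/
theorem sum_card_line_le (P : (Fin 2 → F) → Prop) [DecidablePred P] (x : Fin 2 → F) :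
    ∑ m : F, ({t ∈ Finset.univ.erase (x 0) | P (linePt x m t)} : Finset F).card ≤
      ({z | P z} : Finset (Fin 2 → F)).card := by
  rw [← Finset.card_sigma]
  refine Finset.card_le_card_of_injOn (fun z => linePt x z.1 z.2) ?_ ?_
  · rintro ⟨m, t⟩ h
    simp only [Finset.coe_sigma, Set.mem_sigma_iff, Finset.mem_coe, Finset.mem_filter] at h
    simpa using h.2.2
  · rintro ⟨m, t⟩ h ⟨m', t'⟩ _ heq
    simp only [Finset.coe_sigma, Set.mem_sigma_iff, Finset.mem_coe, Finset.mem_filter,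
      Finset.mem_erase] at h
    have h0 := congrFun heq 0
    have h1 := congrFun heq 1
    simp only [linePt, Matrix.cons_val_zero, Matrix.cons_val_one] at h0 h1
    subst h0
    have h2 : m = m' := mul_right_cancel₀ (sub_ne_zero.2 h.2.1.1) (add_left_cancel h1)
    rw [h2]

theorem card_support_liftRS_ge {η d : ℕ} (hη : 1 ≤ η) {v : (Fin 2 → F) → F}
    (hv : v ∈ liftRS F η d) {x : Fin 2 → F} (hx : v x ≠ 0) :
    Fintype.card F * (Fintype.card F - d - 1) ≤ ({z | v z ≠ 0} : Finset (Fin 2 → F)).card := by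
  refine le_trans ?_ (sum_card_line_le (fun z => v z ≠ 0) x)
  rw [← smul_eq_mul, ← Finset.card_univ]
  refine Finset.card_nsmul_le_sum _ _ _ fun m _ => ?_
  obtain ⟨g, hg, hgv⟩ := exists_poly_on_line hη hv x m
  have hg0 : g ≠ 0 := by
    rintro rfl
    apply hx
    rw [← linePt_self x m, hgv]
    simp
  have h1 : ({t ∈ Finset.univ.erase (x 0) | ¬ v (linePt x m t) ≠ 0} : Finset F).card ≤ d := by
    by_contra hlt
    refine hg0 (eq_of_eval_eq_of_lt_card hg (by simp) _ (not_le.1 hlt) fun t ht => ?_)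
    rw [Finset.mem_filter, not_not] at ht
    rw [← hgv, ht.2]
    simp
  have h2 := Finset.card_filter_add_card_filter_not (s := Finset.univ.erase (x 0))
    (fun t => v (linePt x m t) ≠ 0)
  rw [Finset.card_erase_of_mem (Finset.mem_univ _)] at h2
  omega

theorem codeMinDist_liftRS_ge {η d : ℕ} (hη : 1 ≤ η)
    (hpos : 0 < Module.finrank F (liftRS F η d)) :
    Fintype.card F * (Fintype.card F - d - 1) ≤ codeMinDist (liftRS F η d) := by
  refine le_csInf ?_ ?_
  -- The infimum of the empty set is `0`, so two distinct codewords must be exhibited.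
  · have : Nontrivial (liftRS F η d) := Module.nontrivial_of_finrank_pos hpos
    obtain ⟨⟨u, hu⟩, ⟨w, hw⟩, hne⟩ := this
    exact ⟨_, u, hu, w, hw, fun h => hne (Subtype.ext h), rfl⟩
  · rintro _ ⟨u, hu, w, hw, hne, rfl⟩
    obtain ⟨x, hx⟩ := Function.ne_iff.1 hne
    have h1 := card_support_liftRS_ge hη (Submodule.sub_mem _ hu hw) (x := x)
      (by simpa [sub_eq_zero] using hx)
    simpa [hammingDist, sub_eq_zero] using h1

end

/-! ### The local corrector -/

namespace OracleAlg

variable {ι F : Type*} [DecidableEq ι]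

/-- Read the coordinates in a list, then output a function of the word `w` updated by the symbols
read. -/
def readList (k : (ι → F) → F) : List ι → (ι → F) → OracleAlg ι F
  | [], w => output (k w)
  | i :: is, w => read i fun a => readList k is (Function.update w i a)

theorem numReads_readList (k : (ι → F) → F) (y : ι → F) (is : List ι) (w : ι → F) :
    (readList k is w).numReads y = is.length := by
  induction is generalizing w with
  | nil => rfl
  | cons i is ih => simp [readList, numReads, ih]

theorem run_readList (k : (ι → F) → F) (y : ι → F) (is : List ι) (w : ι → F) :
    (readList k is w).run y = k fun i => if i ∈ is then y i else w i := by
  induction is generalizing w with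
  | nil => simp [readList, run]
  | cons i is ih =>
    simp only [readList, run, ih]
    congr 1
    funext j
    by_cases hj : j ∈ is
    · simp [hj]
    · by_cases hji : j = i
      · subst hji; simp [hj]
      · simp [hj, hji]

end OracleAlg

section

variable {F : Type*} [Field F] [Fintype F] [DecidableEq F]

open Classical in
/-- The value at `x 0` of a polynomial of degree at most `d` that differs from the word `w` on
fewer than `τ` of the other points of the line of slope `m` through `x`. -/
noncomputable def lineDecode (d τ : ℕ) (x : Fin 2 → F) (m : F) (w : (Fin 2 → F) → F) : F :=
  if h : ∃ g : Polynomial F, g.natDegree ≤ d ∧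
      ({t ∈ Finset.univ.erase (x 0) | w (linePt x m t) ≠ g.eval t} : Finset F).card < τ
  then h.choose.eval (x 0) else 0

/-- Two candidates each fail on at most `τ - 1` of `q - 1` points, so they agree on at least `q + 1
- 2τ > d` points and coincide. -/
theorem lineDecode_eq {d τ : ℕ} (hτ : d + 2 * τ ≤ Fintype.card F) (x : Fin 2 → F) (m : F)
    (w : (Fin 2 → F) → F) {g : Polynomial F} (hg : g.natDegree ≤ d)
    (hw : ({t ∈ Finset.univ.erase (x 0) | w (linePt x m t) ≠ g.eval t} : Finset F).card < τ) :
    lineDecode d τ x m w = g.eval (x 0) := by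
  have h : ∃ g : Polynomial F, g.natDegree ≤ d ∧
      ({t ∈ Finset.univ.erase (x 0) | w (linePt x m t) ≠ g.eval t} : Finset F).card < τ :=
    ⟨g, hg, hw⟩
  rw [lineDecode, dif_pos h]
  obtain ⟨h1, h2⟩ := h.choose_spec
  congr 1
  set g' := h.choose
  refine eq_of_eval_eq_of_lt_card h1 hg
    {t ∈ Finset.univ.erase (x 0) | w (linePt x m t) = g.eval t ∧ w (linePt x m t) = g'.eval t}
    ?_ fun t ht => ?_
  · have h3 := Finset.card_filter_add_card_filter_not (s := Finset.univ.erase (x 0))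
      (fun t => w (linePt x m t) = g.eval t ∧ w (linePt x m t) = g'.eval t)
    rw [Finset.card_erase_of_mem (Finset.mem_univ _), Finset.card_univ] at h3
    have h4 : ({t ∈ Finset.univ.erase (x 0) |
        ¬ (w (linePt x m t) = g.eval t ∧ w (linePt x m t) = g'.eval t)} : Finset F) ⊆
        {t ∈ Finset.univ.erase (x 0) | w (linePt x m t) ≠ g.eval t} ∪
        {t ∈ Finset.univ.erase (x 0) | w (linePt x m t) ≠ g'.eval t} := by
      intro t ht
      simp only [Finset.mem_filter, Finset.mem_union] at ht ⊢
      tauto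
    have h5 := (Finset.card_le_card h4).trans (Finset.card_union_le _ _)
    omega
  · rw [Finset.mem_filter] at ht
    rw [← ht.2.1, ht.2.2]

/-- The algorithm that reads the line of slope `m` through `x` except for `x` itself, and decodes
the Reed-Solomon word found there. -/
noncomputable def lineAlg (d τ : ℕ) (x : Fin 2 → F) (m : F) : OracleAlg (Fin 2 → F) F :=
  OracleAlg.readList (lineDecode d τ x m) ((Finset.univ.erase (x 0)).toList.map (linePt x m)) 0

theorem numReads_lineAlg (d τ : ℕ) (x : Fin 2 → F) (m : F) (y : (Fin 2 → F) → F) :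
    (lineAlg d τ x m).numReads y = Fintype.card F - 1 := by
  rw [lineAlg, OracleAlg.numReads_readList, List.length_map, Finset.length_toList,
    Finset.card_erase_of_mem (Finset.mem_univ _), Finset.card_univ]

theorem run_lineAlg {η d τ : ℕ} (hη : 1 ≤ η) (hτ : d + 2 * τ ≤ Fintype.card F) (x : Fin 2 → F)
    (m : F) {y c : (Fin 2 → F) → F} (hc : c ∈ liftRS F η d)
    (hy : ({t ∈ Finset.univ.erase (x 0) | y (linePt x m t) ≠ c (linePt x m t)} : Finset F).card
      < τ) : (lineAlg d τ x m).run y = c x := by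
  obtain ⟨g, hg, hgv⟩ := exists_poly_on_line hη hc x m
  rw [lineAlg, OracleAlg.run_readList, lineDecode_eq hτ x m _ hg, ← hgv, linePt_self]
  refine lt_of_eq_of_lt (congrArg Finset.card (Finset.filter_congr fun t ht => ?_)) hy
  -- All points with `t ≠ x 0` have been read, so the initial word `0` plays no role.
  rw [if_pos (List.mem_map.2 ⟨t, Finset.mem_toList.2 ht, rfl⟩), hgv]

theorem toReal_map_uniform_apply {α β : Type*} [Fintype α] [Nonempty α] [DecidableEq β] (f : α → β)
    (b : β) : (((PMF.uniformOfFintype α).map f) b).toReal =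
      ({a | b = f a} : Finset α).card / (Fintype.card α : ℝ) := by
  classical
  rw [PMF.map_apply, tsum_fintype]
  simp only [PMF.uniformOfFintype_apply]
  rw [← Finset.sum_filter, Finset.sum_const, nsmul_eq_mul, ENNReal.toReal_mul, ENNReal.toReal_inv,
    ENNReal.toReal_natCast, ENNReal.toReal_natCast, div_eq_mul_inv]

/-- Markov's inequality over a uniformly random slope: the lines share at most `δ q^2` errors, so at
most `δ q^2 / τ ≤ ε q` of them carry `τ` or more. -/
theorem isLocallyCorrectable_liftRS {η d τ : ℕ} (hη : 1 ≤ η) (hτ0 : 0 < τ)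
    (hτ : d + 2 * τ ≤ Fintype.card F) {δ ε : ℝ} (hε : δ * Fintype.card F ≤ ε * τ) :
    IsLocallyCorrectable (liftRS F η d) (Fintype.card F - 1) δ ε := by
  refine ⟨fun x => (PMF.uniformOfFintype F).map (lineAlg d τ x), ?_, ?_⟩
  · intro x A hA y
    rw [PMF.mem_support_map_iff] at hA
    obtain ⟨m, -, rfl⟩ := hA
    exact (numReads_lineAlg d τ x m y).le
  · intro x y c hc hdist
    rw [PMF.map_comp, toReal_map_uniform_apply]
    set q := Fintype.card F with hq
    have hq0 : (0 : ℝ) < q := by exact_mod_cast Fintype.card_pos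
    have hτ0' : (0 : ℝ) < τ := by exact_mod_cast hτ0
    set err : F → ℕ := fun m =>
      ({t ∈ Finset.univ.erase (x 0) | y (linePt x m t) ≠ c (linePt x m t)} : Finset F).card
    have h1 : ∑ m : F, err m ≤ hammingDist y c :=
      sum_card_line_le (fun z => y z ≠ c z) x
    have h2 : ({m | τ ≤ err m} : Finset F).card * τ ≤ ∑ m : F, err m := by
      rw [← smul_eq_mul]
      refine (Finset.card_nsmul_le_sum _ err τ fun m hm => (Finset.mem_filter.1 hm).2).trans ?_
      exact Finset.sum_le_sum_of_subset (Finset.filter_subset _ _)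
    have h3 : ({m | ¬ τ ≤ err m} : Finset F) ⊆
        ({m | c x = ((fun A : OracleAlg (Fin 2 → F) F => A.run y) ∘ lineAlg d τ x) m} :
          Finset F) := by
      intro m hm
      simp only [Finset.mem_filter, Finset.mem_univ, true_and, not_le] at hm ⊢
      exact (run_lineAlg hη hτ x m hc hm).symm
    have h4 := Finset.card_le_card h3
    have h5 := Finset.card_filter_add_card_filter_not (s := Finset.univ) (fun m : F => τ ≤ err m)
    rw [Finset.card_univ, ← hq] at h5
    have h6 : (({m | τ ≤ err m} : Finset F).card : ℝ) * τ ≤ δ * q ^ 2 := by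
      have h7 : ((({m | τ ≤ err m} : Finset F).card * τ : ℕ) : ℝ) ≤ hammingDist y c := by
        exact_mod_cast h2.trans h1
      have h8 : (Fintype.card (Fin 2 → F) : ℝ) = (q : ℝ) ^ 2 := by simp [hq]
      rw [h8] at hdist
      push_cast at h7
      exact h7.trans hdist
    have h9 : (({m | τ ≤ err m} : Finset F).card : ℝ) ≤ ε * q := by
      have : (({m | τ ≤ err m} : Finset F).card : ℝ) * τ ≤ ε * q * τ := by nlinarith
      exact le_of_mul_le_mul_right this hτ0'
    rw [le_div_iff₀ hq0]
    have h10 : (({m | τ ≤ err m} : Finset F).card : ℝ) +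
        (({m | ¬ τ ≤ err m} : Finset F).card : ℝ) = q := by exact_mod_cast h5
    have h11 : (({m | ¬ τ ≤ err m} : Finset F).card : ℝ) ≤ _ := Nat.cast_le.2 h4
    linarith

end

/-! ### The asymptotic statement -/

theorem floor_rate_mul_pow {p c e : ℕ} (hp : p.Prime) (hce : c ≤ e) :
    ⌊(1 - ((p : ℝ) ^ c)⁻¹) * (p : ℝ) ^ e⌋₊ = p ^ e - p ^ (e - c) := by
  have hp0 : (p : ℝ) ≠ 0 := by exact_mod_cast hp.ne_zero
  have h : (1 - ((p : ℝ) ^ c)⁻¹) * (p : ℝ) ^ e = ((p ^ e - p ^ (e - c) : ℕ) : ℝ) := by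
    rw [Nat.cast_sub (Nat.pow_le_pow_right hp.pos (by omega))]
    push_cast
    rw [pow_sub₀ _ hp0 hce]
    ring
  rw [h, Nat.floor_natCast]

theorem finrank_liftRS_eq_card_goodExps {F : Type*} [Field F] [Fintype F] {p η c e : ℕ}
    (hp : p.Prime) (hce : c + 1 ≤ e) (hF : Fintype.card F = p ^ e) :
    Module.finrank F (liftRS F η (p ^ e - p ^ (e - c))) =
      (goodExps p η (p ^ e) (p ^ e - p ^ (e - c))).card := by
  have := Fact.mk hp
  have : CharP F p := charP_of_card_eq_prime_pow hF
  have h1 : p ≤ p ^ (e - c) := Nat.le_self_pow (by omega) p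
  have h2 : p ^ (e - c) ≤ p ^ e := Nat.pow_le_pow_right hp.pos (by omega)
  have h3 := hp.two_le
  rw [finrank_liftRS hp (by rw [hF]; omega), hF]

theorem rate_goodExps_ge {p η c e : ℕ} (hp : p.Prime) (hη : 1 ≤ η) (he : c + η ≤ e) :
    1 / (2 * (η : ℝ)) * ∑ ε ∈ Finset.range c,
        (((p : ℝ) ^ ε)⁻¹ - ((p : ℝ) ^ c)⁻¹ - (η + 1) * ((p : ℝ) ^ e)⁻¹) ^ 2 * seqN p η ε ≤
      ((goodExps p η (p ^ e) (p ^ e - p ^ (e - c))).card : ℝ) / ((p : ℝ) ^ e) ^ 2 := by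
  have hp0 : (0 : ℝ) < p := by exact_mod_cast hp.pos
  have hη0 : (0 : ℝ) < η := by exact_mod_cast hη
  have h1 : (∑ ε ∈ Finset.range c, ((primPairs p η ε).card : ℝ) *
      (triangle η (p ^ (e - ε) - p ^ (e - c) - η)).card) ≤
      (goodExps p η (p ^ e) (p ^ e - p ^ (e - c))).card := by
    exact_mod_cast card_goodExps_ge (c := c) hp hη (by omega : c ≤ e)
  rw [le_div_iff₀ (by positivity)]
  refine le_trans ?_ h1
  rw [Finset.mul_sum, Finset.sum_mul]
  refine Finset.sum_le_sum fun ε hε => ?_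
  rw [Finset.mem_range] at hε
  -- These two bounds make the truncated subtractions in the triangle's side exact.
  have hηN : η + 1 ≤ p ^ (e - c) :=
    (Nat.lt_pow_self hp.one_lt).trans_le (Nat.pow_le_pow_right hp.pos (by omega))
  have h2N : 2 * p ^ (e - c) ≤ p ^ (e - ε) :=
    calc 2 * p ^ (e - c) ≤ p * p ^ (e - c) := Nat.mul_le_mul_right _ hp.two_le
      _ = p ^ (e - c + 1) := (pow_succ' _ _).symm
      _ ≤ p ^ (e - ε) := Nat.pow_le_pow_right hp.pos (by omega)
  have h2 := card_triangle_ge (A := p ^ (e - ε) - p ^ (e - c) - η) hη (by omega)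
  rw [seqN_eq_card hp hη]
  have h3 : ((p ^ (e - ε) - p ^ (e - c) - η : ℕ) : ℝ) - 1 =
      (((p : ℝ) ^ ε)⁻¹ - ((p : ℝ) ^ c)⁻¹ - (η + 1) * ((p : ℝ) ^ e)⁻¹) * (p : ℝ) ^ e := by
    rw [Nat.cast_sub (by omega), Nat.cast_sub (by omega)]
    push_cast
    rw [pow_sub₀ _ hp0.ne' (by omega : ε ≤ e), pow_sub₀ _ hp0.ne' (by omega : c ≤ e)]
    field_simp
    ring
  rw [h3] at h2
  refine le_trans (le_of_eq ?_) (mul_le_mul_of_nonneg_left h2 (Nat.cast_nonneg _))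
  ring

theorem rate_bound_pos {p η c : ℕ} (hp : p.Prime) (hη : 1 ≤ η) (hc : 1 ≤ c) :
    0 < 1 / (2 * (η : ℝ)) * ∑ ε ∈ Finset.range c,
        (((p : ℝ) ^ ε)⁻¹ - ((p : ℝ) ^ c)⁻¹) ^ 2 * seqN p η ε := by
  have hη0 : (0 : ℝ) < η := by exact_mod_cast hη
  refine mul_pos (by positivity) (Finset.sum_pos' (fun ε _ => ?_) ⟨0, Finset.mem_range.2 hc, ?_⟩)
  · rw [seqN_eq_card hp hη]
    positivity
  · have h1 : (1 : ℝ) < (p : ℝ) ^ c := one_lt_pow₀ (by exact_mod_cast hp.one_lt) (by omega)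
    have h2 := inv_lt_one_of_one_lt₀ h1
    rw [seqN, pow_zero, inv_one, mul_one]
    exact pow_pos (by linarith) 2

theorem mainTheorem2 (p η c : ℕ) (hp : p.Prime) (hη : 1 ≤ η) (hc : 1 ≤ c)
    (γ : ℝ) (hγ : γ = 1 - ((p : ℝ) ^ c)⁻¹)
    (F : ℕ → Type*) [∀ e, Field (F e)] [∀ e, Fintype (F e)] [∀ e, DecidableEq (F e)]
    (hF : ∀ e, 1 ≤ e → Fintype.card (F e) = p ^ e)
    (C : ∀ e, Submodule (F e) ((Fin 2 → F e) → F e))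
    (hC : ∀ e, c + 1 ≤ e → C e = liftRS (F e) η ⌊γ * (p : ℝ) ^ e⌋₊) :
    -- the information rates converge, and their limit satisfies the lower bound
    (∃ R : ℝ, Tendsto (fun e => codeRate (C e)) atTop (𝓝 R) ∧
      1 / (2 * (η : ℝ)) * ∑ ε ∈ Finset.range c,
        (((p : ℝ) ^ ε)⁻¹ - ((p : ℝ) ^ c)⁻¹) ^ 2 * seqN p η ε ≤ R) ∧
    -- the lower bound is positive
    0 < 1 / (2 * (η : ℝ)) * ∑ ε ∈ Finset.range c,
        (((p : ℝ) ^ ε)⁻¹ - ((p : ℝ) ^ c)⁻¹) ^ 2 * seqN p η ε ∧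
    AsymptoticallyGood C ∧
    -- local correction from a constant fraction of errors, reading `p ^ e - 1` of `p ^ (2 e)`
    -- symbols, a number which does not exceed the dimension for large `e`
    (∀ᶠ e in atTop, p ^ e - 1 ≤ Module.finrank (F e) (C e)) ∧
    ∀ e, c + 1 ≤ e → ∀ δ : ℝ, 0 < δ → δ ≤ (1 - γ) / 4 →
      IsLocallyCorrectable (C e) (p ^ e - 1) δ (3 / (1 - γ) * δ) ∧
      (Even (p ^ e - ⌊γ * (p : ℝ) ^ e⌋₊) →
        IsLocallyCorrectable (C e) (p ^ e - 1) δ (2 / (1 - γ) * δ)) := by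
  have hp0 : (0 : ℝ) < p := by exact_mod_cast hp.pos
  have hp1 : (1 : ℝ) < p := by exact_mod_cast hp.one_lt
  have hfloor : ∀ e, c + 1 ≤ e → ⌊γ * (p : ℝ) ^ e⌋₊ = p ^ e - p ^ (e - c) := fun e he => by
    rw [hγ, floor_rate_mul_pow hp (by omega)]
  have hC' : ∀ e, c + 1 ≤ e → C e = liftRS (F e) η (p ^ e - p ^ (e - c)) := fun e he => by
    rw [hC e he, hfloor e he]
  have hNq : ∀ e, c + 1 ≤ e → p ^ e = p ^ (e - c) * p ^ c := fun e he => by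
    rw [← pow_add]; congr 1; omega
  have hN2 : ∀ e, c + 1 ≤ e → 2 ≤ p ^ (e - c) := fun e he =>
    hp.two_le.trans (Nat.le_self_pow (by omega) p)
  have hNle : ∀ e, p ^ (e - c) ≤ p ^ e := fun e => Nat.pow_le_pow_right hp.pos (by omega)
  have hcard : ∀ e, c + 1 ≤ e → Fintype.card (Fin 2 → F e) = (p ^ e) ^ 2 := fun e he => by
    rw [Fintype.card_fun, Fintype.card_fin, hF e (by omega)]
  have hrate : ∀ e, c + 1 ≤ e → codeRate (C e) =
      ((goodExps p η (p ^ e) (p ^ e - p ^ (e - c))).card : ℝ) / ((p : ℝ) ^ e) ^ 2 := by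
    intro e he
    rw [codeRate, hC' e he, finrank_liftRS_eq_card_goodExps hp he (hF e (by omega)), hcard e he]
    push_cast
    rfl
  set L : ℝ := 1 / (2 * (η : ℝ)) * ∑ ε ∈ Finset.range c,
        (((p : ℝ) ^ ε)⁻¹ - ((p : ℝ) ^ c)⁻¹) ^ 2 * seqN p η ε with hL
  have hLpos : 0 < L := rate_bound_pos hp hη hc
  have hpow : Tendsto (fun e : ℕ => (p : ℝ) ^ e) atTop atTop :=
    tendsto_pow_atTop_atTop_of_one_lt hp1
  obtain ⟨R, hR⟩ := exists_tendsto_card_goodExps (η := η) hp hc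
  have hRtend : Tendsto (fun e => codeRate (C e)) atTop (𝓝 R) :=
    hR.congr' (eventually_atTop.2 ⟨c + 1, fun e he => (hrate e he).symm⟩)
  have hLR : L ≤ R := by
    have h1 : Tendsto (fun e : ℕ => 1 / (2 * (η : ℝ)) * ∑ ε ∈ Finset.range c,
        (((p : ℝ) ^ ε)⁻¹ - ((p : ℝ) ^ c)⁻¹ - (η + 1) * ((p : ℝ) ^ e)⁻¹) ^ 2 * seqN p η ε)
        atTop (𝓝 L) := by
      refine Tendsto.const_mul _ (tendsto_finsetSum _ fun ε _ => Tendsto.mul_const _ ?_)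
      have h2 := (hpow.inv_tendsto_atTop.const_mul ((η : ℝ) + 1)).const_sub
        (((p : ℝ) ^ ε)⁻¹ - ((p : ℝ) ^ c)⁻¹)
      rw [mul_zero, sub_zero] at h2
      exact h2.pow 2
    exact le_of_tendsto_of_tendsto h1 hR
      (eventually_atTop.2 ⟨c + η, fun e he => rate_goodExps_ge hp hη he⟩)
  have hrho : ∀ᶠ e in atTop, L / 2 ≤ codeRate (C e) :=
    (hRtend.eventually_const_lt (by linarith : L / 2 < R)).mono fun e he => he.le
  have hdim : ∀ e, c + 1 ≤ e → L / 2 ≤ codeRate (C e) →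
      L / 2 * ((p : ℝ) ^ e) ^ 2 ≤ Module.finrank (F e) (C e) := by
    intro e he h
    rw [codeRate, hcard e he, le_div_iff₀ (by exact_mod_cast pow_pos (pow_pos hp.pos e) 2)] at h
    exact_mod_cast h
  -- The relative distance `p^(-c)/2` comes from `q (N - 1) ≥ q N / 2`, where `N = p^(-c) q ≥ 2`.
  refine ⟨⟨R, hRtend, hLR⟩, hLpos, ⟨?_, L / 2, by positivity, ((p : ℝ) ^ c)⁻¹ / 2,
    by positivity, ?_⟩, ?_, ?_⟩
  · have h1 : Tendsto (fun e : ℕ => (p ^ e) ^ 2) atTop atTop :=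
      (tendsto_pow_atTop two_ne_zero).comp (tendsto_pow_atTop_atTop_of_one_lt hp.one_lt)
    exact h1.congr' (eventually_atTop.2 ⟨c + 1, fun e he => (hcard e he).symm⟩)
  · filter_upwards [hrho, eventually_ge_atTop (c + 1)] with e hρ he
    refine ⟨hρ, ?_⟩
    have h1 := hdim e he hρ
    have hpos : 0 < Module.finrank (F e) (C e) := by
      have h2 : (0 : ℝ) < Module.finrank (F e) (C e) := lt_of_lt_of_le (by positivity) h1
      exact_mod_cast h2
    rw [hC' e he] at hpos ⊢
    have h2 := codeMinDist_liftRS_ge hη hpos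
    rw [hF e (by omega)] at h2
    have h3 : p ^ e - (p ^ e - p ^ (e - c)) - 1 = p ^ (e - c) - 1 := by
      have := hNle e
      omega
    rw [h3] at h2
    have h4 : (p : ℝ) ^ e * ((p : ℝ) ^ (e - c) - 1) ≤
        codeMinDist (liftRS (F e) η (p ^ e - p ^ (e - c))) := by
      have h5 : ((p ^ (e - c) - 1 : ℕ) : ℝ) = (p : ℝ) ^ (e - c) - 1 := by
        rw [Nat.cast_sub (by have := hN2 e he; omega)]
        push_cast
        rfl
      rw [← h5]
      exact_mod_cast h2
    refine le_trans ?_ h4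
    have h6 : (p : ℝ) ^ e = (p : ℝ) ^ (e - c) * (p : ℝ) ^ c := by exact_mod_cast hNq e he
    have h7 : (2 : ℝ) ≤ (p : ℝ) ^ (e - c) := by exact_mod_cast hN2 e he
    have h8 : ((p : ℝ) ^ c)⁻¹ / 2 * ((p : ℝ) ^ e) ^ 2 =
        (p : ℝ) ^ e * ((p : ℝ) ^ (e - c) / 2) := by
      rw [h6]
      field_simp
    rw [hcard e he]
    push_cast
    rw [h8]
    have h9 : (0 : ℝ) < (p : ℝ) ^ e := by positivity
    exact mul_le_mul_of_nonneg_left (by linarith) h9.le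
  · filter_upwards [hrho, eventually_ge_atTop (c + 1),
      hpow.eventually_ge_atTop (2 / L)] with e hρ he hlarge
    have h1 := hdim e he hρ
    rw [div_le_iff₀ hLpos] at hlarge
    have h9 : (0 : ℝ) < (p : ℝ) ^ e := by positivity
    have h2 : (p : ℝ) ^ e ≤ Module.finrank (F e) (C e) := by
      nlinarith [mul_le_mul_of_nonneg_left hlarge h9.le]
    have h3 : p ^ e ≤ Module.finrank (F e) (C e) := by exact_mod_cast h2
    omega
  · intro e he δ hδ _
    have hγ1 : 1 - γ = ((p : ℝ) ^ c)⁻¹ := by rw [hγ]; ring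
    have hcF := hF e (by omega)
    have hN := hN2 e he
    have hle := hNle e
    have hqr : (p : ℝ) ^ e = (p : ℝ) ^ (e - c) * (p : ℝ) ^ c := by exact_mod_cast hNq e he
    -- The decoding threshold is `τ = ⌊N/2⌋`. As `N ≥ 2`, `N ≤ 3τ` always, and `N = 2τ` for even
    -- `N`; hence the constants `3` and `2`.
    have key : ∀ n : ℕ, p ^ (e - c) ≤ n * (p ^ (e - c) / 2) →
        IsLocallyCorrectable (C e) (p ^ e - 1) δ (n / (1 - γ) * δ) := by
      intro n hn
      rw [hC' e he, ← hcF]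
      refine isLocallyCorrectable_liftRS (τ := p ^ (e - c) / 2) hη (by omega)
        (by rw [hcF]; omega) ?_
      have hn' : (p : ℝ) ^ (e - c) ≤ n * ((p ^ (e - c) / 2 : ℕ) : ℝ) := by exact_mod_cast hn
      rw [hcF, hγ1, div_inv_eq_mul, Nat.cast_pow, hqr]
      have hpc : (0 : ℝ) < (p : ℝ) ^ c := by positivity
      calc δ * ((p : ℝ) ^ (e - c) * (p : ℝ) ^ c)
          ≤ δ * ((n * ((p ^ (e - c) / 2 : ℕ) : ℝ)) * (p : ℝ) ^ c) := by gcongr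
        _ = n * (p : ℝ) ^ c * δ * ((p ^ (e - c) / 2 : ℕ) : ℝ) := by ring
    refine ⟨by simpa using key 3 (by omega), fun heven => ?_⟩
    rw [hfloor e he, Nat.sub_sub_self hle] at heven
    obtain ⟨r, hr⟩ := heven
    simpa using key 2 (by omega)
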